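/- Let $0<r<1$. An $r$-norm on a real vector space $Z$ is a map $\|\cdot\|_Z:Z\to\mathbb R$ with $\|z\|_Z>0$ for $z\ne0$, $\|\alpha z\|_Z=|\alpha|\,\|z\|_Z$ and $\|z+w\|_Z^r\le\|z\|_Z^r+\|w\|_Z^r$; $Z$ is an $r$-normed quasi-Banach space if it is complete for the metric $\|z-w\|_Z^r$. For real Banach spaces $X,Y$ with closed unit balls $B_X,B_Y$, let $d_{GH}(X,Y)$ be the Gromov–Hausdorff distance of the metric spaces $B_X$ and $B_Y$, i.e. the infimum of all $\epsilon\ge0$ such that $B_X$ and $B_Y$ embed isometrically into some pseudometric space with the Hausdorff distance of the images at most $\epsilon$. Let $d_r(X,Y)$ be the infimum, over all $r$-normed quasi-Banach spaces $Z$ and all linear isometric embeddings $U:X\to Z$, $V:Y\to Z$, of $$\max\Big\{\sup_{x\in B_X}\inf_{y\in B_Y}\|Ux-Vy\|_Z,\ \sup_{y\in B_Y}\inf_{x\in B_X}\|Vy-Ux\|_Z\Big\}.$$ **Theorem 3.6.** For every $0<r<1$ there is a function $f_r:[0,1]\to[0,1]$ with $f_r(0)=0$, $f_r((0,1])\subseteq(0,1]$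 and $\lim_{\epsilon\to0^+}f_r(\epsilon)=0$ such that, for all real Banach spaces $X$ and $Y$, $0\le d_{GH}(X,Y)\le1$ and $$2^{-2/r+1}\,d_{GH}(X,Y)\le d_r(X,Y)\le f_r\big(d_{GH}(X,Y)\big).$$ In this sense the Gromov–Hausdorff distance and $d_r$ are equivalent. -/

import Mathlib

open Set Filter Topology

universe u v

/-- The Gromov-Hausdorff distance of two bounded (pseudo)metric spaces: the infimum of all `ε ≥ 0`
such that `A` and `B` embed isometrically into some pseudometric space `M` with the Hausdorff
distance of the images at most `ε`. -/
noncomputable def ghDistance (A : Type u) (B : Type v) [PseudoMetricSpace A]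
    [PseudoMetricSpace B] : ℝ :=
  sInf {ε : ℝ | 0 ≤ ε ∧ ∃ (M : Type (max u v)) (_ : PseudoMetricSpace M) (i : A → M) (j : B → M),
    Isometry i ∧ Isometry j ∧
      Metric.hausdorffEDist (range i) (range j) ≤ ENNReal.ofReal ε}

/-- The Gromov-Hausdorff distance of two Banach spaces, i.e. that of their closed unit balls. -/
noncomputable def dGH (X : Type u) (Y : Type v) [NormedAddCommGroup X] [NormedAddCommGroup Y] : ℝ :=
  ghDistance (Metric.closedBall (0 : X) 1) (Metric.closedBall (0 : Y) 1)

/-- An `r`-norm on a real vector space. -/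
structure RNorm (r : ℝ) (Z : Type u) [AddCommGroup Z] [Module ℝ Z] where
  toFun : Z → ℝ
  pos_of_ne_zero : ∀ z, z ≠ 0 → 0 < toFun z
  smul_eq : ∀ (a : ℝ) (z : Z), toFun (a • z) = |a| * toFun z
  add_rpow_le : ∀ z w : Z, toFun (z + w) ^ r ≤ toFun z ^ r + toFun w ^ r

namespace RNorm

variable {r : ℝ} {Z : Type u} [AddCommGroup Z] [Module ℝ Z]

/-- Completeness of `Z` for the metric `d(z, w) = ‖z - w‖ ^ r`: every Cauchy sequence converges. -/
def IsComplete (N : RNorm r Z) : Prop :=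
  ∀ s : ℕ → Z,
    (∀ ε : ℝ, 0 < ε → ∃ k : ℕ, ∀ m n : ℕ, k ≤ m → k ≤ n → N.toFun (s m - s n) ^ r < ε) →
    ∃ z : Z, ∀ ε : ℝ, 0 < ε → ∃ k : ℕ, ∀ n : ℕ, k ≤ n → N.toFun (s n - z) ^ r < ε

/-- The Hausdorff distance of two (nonempty, bounded) sets, measured by the `r`-norm itself
(and not by the metric `‖z - w‖ ^ r`). -/
noncomputable def hausdorffDistance (N : RNorm r Z) (A B : Set Z) : ℝ :=
  max (⨆ a : A, ⨅ b : B, N.toFun ((a : Z) - (b : Z)))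
    (⨆ b : B, ⨅ a : A, N.toFun ((b : Z) - (a : Z)))

end RNorm

/-- The distance `d_r(X, Y)`: the infimum of the Hausdorff distance of the images of the closed unit
balls over all linear isometric embeddings `U`, `V` of `X` and `Y` into a common `r`-normed
quasi-Banach space `Z`. -/
noncomputable def dR (r : ℝ) (X : Type u) (Y : Type v) [NormedAddCommGroup X] [NormedSpace ℝ X]
    [NormedAddCommGroup Y] [NormedSpace ℝ Y] : ℝ :=
  sInf {δ : ℝ | ∃ (Z : Type (max u v)) (_ : AddCommGroup Z) (_ : Module ℝ Z) (N : RNorm r Z)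
    (U : X →ₗ[ℝ] Z) (V : Y →ₗ[ℝ] Z),
      N.IsComplete ∧ (∀ x, N.toFun (U x) = ‖x‖) ∧ (∀ y, N.toFun (V y) = ‖y‖) ∧
      δ = N.hausdorffDistance (U '' Metric.closedBall 0 1) (V '' Metric.closedBall 0 1)}

-- Both distances are compared through correspondences between the unit balls: up to arbitrarily
-- small slack, the Gromov–Hausdorff distance is half the least distortion.
--
-- Lower bound. If the balls are δ-close in an r-normed space, pair the points at r-distance less
-- than δ. A difference v of two points of one ball is within 2δ of ‖v‖ times a unit-ball point of
-- the other space. Comparing norms inside that Banach space, where the ordinary triangle inequality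
-- holds, bounds the distortion by 4^(1/r) δ (`RNorm.norm_le_norm_add`), whence the constant
-- 2^(-2/r+1).
--
-- Upper bound. A correspondence T of small distortion almost preserves midpoints, by a quantitative
-- Mazur–Ulam argument: conjugating by reflections doubles the displacement of a midpoint while only
-- doubling the distortion, so iteration forces the displacement to be small
-- (`IsLensCorrespondence.norm_sub_midpoint_le`). Hence T extends to a positively homogeneous,
-- almost additive map F : X → Y.
--
-- For r < 1, splitting a sum into two halves of equal r-weight gains the factor 2^(1-1/r) < 1. The
-- errors of F on long linear combinations therefore form a geometric series, with a bound
-- independent of the length (`IsApproxAffine.norm_extension_fstCombination_sub_le`). At r = 1 the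
-- factor is 1 and this argument breaks down.
--
-- This says exactly that one may impose ‖x - y‖ ≤ τ on all related pairs in an r-normed sum of X
-- and Y without shrinking either norm (`IsLinking.linkedGauge_left`,
-- `IsLinking.linkedGauge_right`). The estimates depend only on r and the distortion, so one modulus
-- serves all pairs of spaces.

universe w

set_option linter.unusedSectionVars false

/-! ### Approximate Mazur–Ulam theorem on lenses. -/

section ApproximateMazurUlam

theorem norm_reflect_sub_left {E : Type*} [NormedAddCommGroup E] (p q x : E) :
    ‖p + q - x - p‖ = ‖x - q‖ := by
  rw [← norm_neg]; congr 1; abel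

theorem norm_reflect_sub_right {E : Type*} [NormedAddCommGroup E] (p q x : E) :
    ‖p + q - x - q‖ = ‖x - p‖ := by
  rw [← norm_neg]; congr 1; abel

theorem norm_reflect_sub_reflect {E : Type*} [NormedAddCommGroup E] (p x y : E) :
    ‖p - x - (p - y)‖ = ‖x - y‖ := by
  rw [← norm_neg]; congr 1; abel

variable {X : Type u} {Y : Type v} [NormedAddCommGroup X] [NormedSpace ℝ X]
  [NormedAddCommGroup Y] [NormedSpace ℝ Y]

theorem norm_midpoint_sub_left (a b : X) : ‖(1 / 2 : ℝ) • (a + b) - a‖ = ‖a - b‖ / 2 := by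
  have : (1 / 2 : ℝ) • (a + b) - a = (-(1 / 2 : ℝ)) • (a - b) := by module
  rw [this, norm_smul]; norm_num; ring

theorem norm_midpoint_sub_right (a b : X) : ‖(1 / 2 : ℝ) • (a + b) - b‖ = ‖a - b‖ / 2 := by
  have : (1 / 2 : ℝ) • (a + b) - b = (1 / 2 : ℝ) • (a - b) := by module
  rw [this, norm_smul]; norm_num; ring

theorem norm_sub_reflect_midpoint (a b w : X) :
    ‖w - (a + b - w)‖ = 2 * ‖w - (1 / 2 : ℝ) • (a + b)‖ := by
  have : w - (a + b - w) = (2 : ℝ) • (w - (1 / 2 : ℝ) • (a + b)) := by module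
  rw [this, norm_smul]; norm_num

theorem norm_reflect_sub_midpoint (a b w : X) :
    ‖(a + b - w) - (1 / 2 : ℝ) • (a + b)‖ = ‖w - (1 / 2 : ℝ) • (a + b)‖ := by
  rw [← norm_neg]; congr 1; module

/-- A relation with distortion at most `δ` which nearly maps `a, b` to `c, d` and is total, in both
directions, on the points at distance at most `R` from both of them. -/
structure IsLensCorrespondence (T : X → Y → Prop) (a b : X) (c d : Y) (δ R : ℝ) : Prop where
  nonneg : 0 ≤ δ
  distortion : ∀ {x x' y y'}, T x y → T x' y' → |‖x - x'‖ - ‖y - y'‖| ≤ δ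
  fst_close : ∀ {x y}, T x y → |‖x - a‖ - ‖y - c‖| ≤ δ
  snd_close : ∀ {x y}, T x y → |‖x - b‖ - ‖y - d‖| ≤ δ
  exists_right : ∀ x, ‖x - a‖ ≤ R → ‖x - b‖ ≤ R → ∃ y, T x y
  exists_left : ∀ y, ‖y - c‖ ≤ R → ‖y - d‖ ≤ R → ∃ x, T x y

/-- The composition of `T`, the reflection exchanging `c` and `d`, the inverse of `T` and the
reflection exchanging `a` and `b`. -/
def reflectedCommutator (T : X → Y → Prop) (a b : X) (c d : Y) : X → X → Prop :=
  fun p q => ∃ u, T p u ∧ T (a + b - q) (c + d - u)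

/-- Each reflection is an isometry exchanging the two foci, so the composite has foci a, b on both
sides. T is used twice, which doubles the distortion; its first use can push a point outward by δ,
which costs δ in the radius. -/
theorem IsLensCorrespondence.reflectedCommutator {T : X → Y → Prop} {a b : X} {c d : Y} {δ R : ℝ}
    (h : IsLensCorrespondence T a b c d δ R) :
    IsLensCorrespondence (reflectedCommutator T a b c d) a b a b (2 * δ) (R - δ) := by
  have hδ := h.nonneg
  refine ⟨by linarith, ?_, ?_, ?_, ?_, ?_⟩
  · rintro x x' q q' ⟨u, hu, hq⟩ ⟨u', hu', hq'⟩
    have h1 := abs_le.1 (h.distortion hu hu')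
    have h2 := abs_le.1 (h.distortion hq hq')
    rw [norm_reflect_sub_reflect, norm_reflect_sub_reflect] at h2
    exact abs_le.2 ⟨by linarith, by linarith⟩
  · rintro x q ⟨u, hu, hq⟩
    have h1 := abs_le.1 (h.fst_close hu)
    have h2 := abs_le.1 (h.snd_close hq)
    rw [norm_reflect_sub_right, norm_reflect_sub_right] at h2
    exact abs_le.2 ⟨by linarith, by linarith⟩
  · rintro x q ⟨u, hu, hq⟩
    have h1 := abs_le.1 (h.snd_close hu)
    have h2 := abs_le.1 (h.fst_close hq)
    rw [norm_reflect_sub_left, norm_reflect_sub_left] at h2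
    exact abs_le.2 ⟨by linarith, by linarith⟩
  · intro x ha hb
    obtain ⟨y, hy⟩ := h.exists_right x (by linarith) (by linarith)
    have h1 := abs_le.1 (h.fst_close hy)
    have h2 := abs_le.1 (h.snd_close hy)
    obtain ⟨v, hv⟩ := h.exists_left (c + d - y)
      (by rw [norm_reflect_sub_left]; linarith) (by rw [norm_reflect_sub_right]; linarith)
    exact ⟨a + b - v, y, hy, by simpa using hv⟩
  · intro q ha hb
    obtain ⟨y, hy⟩ := h.exists_right (a + b - q)
      (by rw [norm_reflect_sub_left]; linarith) (by rw [norm_reflect_sub_right]; linarith)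
    have h1 := abs_le.1 (h.fst_close hy)
    have h2 := abs_le.1 (h.snd_close hy)
    rw [norm_reflect_sub_left] at h1
    rw [norm_reflect_sub_right] at h2
    obtain ⟨p, hp⟩ := h.exists_left (c + d - y)
      (by rw [norm_reflect_sub_left]; linarith) (by rw [norm_reflect_sub_right]; linarith)
    exact ⟨p, c + d - y, hp, by simpa using hy⟩

/-- The reflection exchanging c and d moves w by twice its distance to their midpoint. Pulling back
by T loses at most δ, and the last reflection fixes the midpoint of a and b. -/
theorem IsLensCorrespondence.exists_reflectedCommutator_far {T : X → Y → Prop} {a b : X} {c d : Y}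
    {δ R : ℝ} (h : IsLensCorrespondence T a b c d δ R) (hR : ‖a - b‖ / 2 + δ ≤ R) {w : Y}
    (hw : T ((1 / 2 : ℝ) • (a + b)) w) :
    ∃ q, _root_.reflectedCommutator T a b c d ((1 / 2 : ℝ) • (a + b)) q ∧
      2 * ‖w - (1 / 2 : ℝ) • (c + d)‖ - δ ≤ ‖q - (1 / 2 : ℝ) • (a + b)‖ := by
  have h1 := abs_le.1 (h.fst_close hw)
  have h2 := abs_le.1 (h.snd_close hw)
  rw [norm_midpoint_sub_left] at h1
  rw [norm_midpoint_sub_right] at h2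
  obtain ⟨v, hv⟩ := h.exists_left (c + d - w)
    (by rw [norm_reflect_sub_left]; linarith) (by rw [norm_reflect_sub_right]; linarith)
  refine ⟨a + b - v, ⟨w, hw, by simpa using hv⟩, ?_⟩
  have h3 := abs_le.1 (h.distortion hw hv)
  rw [norm_sub_reflect_midpoint] at h3
  rw [norm_reflect_sub_midpoint, norm_sub_rev v]
  linarith

/-- Passing to the commutator replaces δ by 2δ and halves the bound: the displacement is at most
half of (bound for 2δ) + δ. The radius shrinks by δ + 2δ + 4δ + ..., whence the factor 2^(n+1) - 1.
-/
theorem IsLensCorrespondence.norm_sub_midpoint_le_self (n : ℕ) : ∀ {T : X → X → Prop} {a b : X}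
    {δ R : ℝ}, IsLensCorrespondence T a b a b δ R → ‖a - b‖ / 2 + (2 ^ (n + 1) - 1) * δ ≤ R →
    ∀ {w : X}, T ((1 / 2 : ℝ) • (a + b)) w →
      ‖w - (1 / 2 : ℝ) • (a + b)‖ ≤ ‖a - b‖ / 2 ^ n + (n + 1) * δ := by
  induction n with
  | zero =>
    intro T a b δ R h hR w hw
    have h1 := abs_le.1 (h.fst_close hw)
    have h2 := norm_sub_le_norm_sub_add_norm_sub w a ((1 / 2 : ℝ) • (a + b))
    rw [norm_sub_rev a ((1 / 2 : ℝ) • (a + b)), norm_midpoint_sub_left] at h2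
    rw [norm_midpoint_sub_left] at h1
    simp only [pow_zero, div_one, Nat.cast_zero]
    linarith
  | succ n ih =>
    intro T a b δ R h hR w hw
    have hδ := h.nonneg
    have h2n : (1 : ℝ) ≤ 2 ^ n := one_le_pow₀ (by norm_num)
    have hR' : ‖a - b‖ / 2 + δ ≤ R := by
      rw [pow_succ, pow_succ] at hR
      nlinarith
    obtain ⟨q, hq, hqw⟩ := h.exists_reflectedCommutator_far hR' hw
    have h1 := ih h.reflectedCommutator (by rw [pow_succ] at hR; linarith) hq
    have h3 : ‖a - b‖ / 2 ^ (n + 1) = ‖a - b‖ / 2 ^ n / 2 := by rw [pow_succ, div_div]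
    rw [h3]; push_cast
    linarith

/-- Approximate Mazur-Ulam theorem: a relation of small distortion nearly preserves midpoints. -/
theorem IsLensCorrespondence.norm_sub_midpoint_le (n : ℕ) {T : X → Y → Prop} {a b : X} {c d : Y}
    {δ R : ℝ} (h : IsLensCorrespondence T a b c d δ R)
    (hR : ‖a - b‖ / 2 + 2 ^ (n + 2) * δ ≤ R) {w : Y} (hw : T ((1 / 2 : ℝ) • (a + b)) w) :
    ‖w - (1 / 2 : ℝ) • (c + d)‖ ≤ ‖a - b‖ / 2 ^ (n + 1) + (n + 2) * δ := by
  have hδ := h.nonneg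
  have h2n : (1 : ℝ) ≤ 2 ^ n := one_le_pow₀ (by norm_num)
  rw [pow_succ, pow_succ] at hR
  obtain ⟨q, hq, hqw⟩ := h.exists_reflectedCommutator_far (by nlinarith) hw
  have h1 := norm_sub_midpoint_le_self n h.reflectedCommutator
    (by rw [pow_succ]; linarith) hq
  have h3 : ‖a - b‖ / 2 ^ (n + 1) = ‖a - b‖ / 2 ^ n / 2 := by rw [pow_succ, div_div]
  rw [h3]
  linarith

end ApproximateMazurUlam

/-! ### Correspondences of the unit balls almost preserve midpoints. -/

section BallCorrespondence

variable {X : Type u} {Y : Type v} [NormedAddCommGroup X] [NormedSpace ℝ X]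
  [NormedAddCommGroup Y] [NormedSpace ℝ Y]

/-- A correspondence of distortion at most `δ` between the closed unit balls. -/
structure IsBallCorrespondence (T : X → Y → Prop) (δ : ℝ) : Prop where
  norm_left_le : ∀ {x y}, T x y → ‖x‖ ≤ 1
  norm_right_le : ∀ {x y}, T x y → ‖y‖ ≤ 1
  exists_right : ∀ x, ‖x‖ ≤ 1 → ∃ y, T x y
  exists_left : ∀ y, ‖y‖ ≤ 1 → ∃ x, T x y
  distortion : ∀ {x x' y y'}, T x y → T x' y' → |‖x - x'‖ - ‖y - y'‖| ≤ δ

/-- The relation `T` preserves midpoints up to an error of at most `θ`, and norms up to `2 θ`. -/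
structure IsApproxAffine (T : X → Y → Prop) (θ : ℝ) : Prop extends IsBallCorrespondence T θ where
  norm_sub_midpoint_le : ∀ {a b c d w}, T a c → T b d → T ((1 / 2 : ℝ) • (a + b)) w →
    ‖w - (1 / 2 : ℝ) • (c + d)‖ ≤ θ

namespace IsBallCorrespondence

variable {T : X → Y → Prop} {δ : ℝ}

theorem swap (h : IsBallCorrespondence T δ) : IsBallCorrespondence (fun y x => T x y) δ :=
  ⟨h.norm_right_le, h.norm_left_le, h.exists_left, h.exists_right, fun h1 h2 => by
    rw [abs_sub_comm]; exact h.distortion h1 h2⟩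

theorem nonneg (h : IsBallCorrespondence T δ) : 0 ≤ δ := by
  obtain ⟨y, hy⟩ := h.exists_right 0 (by simp)
  exact (abs_nonneg _).trans (h.distortion hy hy)

/-- The unit vector opposite to y is at distance 1 + ‖y‖ from y, but its partner is at distance at
most 1 from 0. -/
theorem norm_le_of_zero (h : IsBallCorrespondence T δ) {y : Y} (hy : T 0 y) : ‖y‖ ≤ δ := by
  rcases eq_or_ne y 0 with rfl | hy0
  · simpa using h.nonneg
  have hn : ‖y‖ ≠ 0 := norm_ne_zero_iff.2 hy0
  obtain ⟨x, hx⟩ := h.exists_left (-(‖y‖⁻¹ • y)) (by simp [norm_smul, hn])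
  have h1 := abs_le.1 (h.distortion hx hy)
  have h2 := h.norm_left_le hx
  have h3 : -(‖y‖⁻¹ • y) - y = -((‖y‖⁻¹ + 1) • y) := by module
  rw [h3, norm_neg, norm_smul, Real.norm_of_nonneg (by positivity), add_mul,
    inv_mul_cancel₀ hn, sub_zero] at h1
  linarith

theorem isLensCorrespondence (h : IsBallCorrespondence T δ) {a b : X} {c d : Y} (hac : T a c)
    (hbd : T b d) {R : ℝ} (ha : ‖a‖ + R ≤ 1) (hc : ‖c‖ + R ≤ 1) :
    IsLensCorrespondence T a b c d δ R := by
  refine ⟨h.nonneg, h.distortion, fun h1 => h.distortion h1 hac, fun h1 => h.distortion h1 hbd,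
    fun x hx _ => h.exists_right x ?_, fun y hy _ => h.exists_left y ?_⟩
  · linarith [norm_le_norm_add_norm_sub' x a]
  · linarith [norm_le_norm_add_norm_sub' y c]

theorem abs_norm_sub_norm_le (h : IsBallCorrespondence T δ) {x : X} {y : Y} (hy : T x y) :
    |‖x‖ - ‖y‖| ≤ 2 * δ := by
  obtain ⟨c, hc⟩ := h.exists_right 0 (by simp)
  have h1 := abs_le.1 (h.distortion hy hc)
  have h2 := h.norm_le_of_zero hc
  rw [sub_zero] at h1
  have h3 := norm_sub_le y c
  have h4 := norm_sub_norm_le y c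
  exact abs_le.2 ⟨by linarith, by linarith⟩

theorem norm_sub_half_le (h : IsBallCorrespondence T δ) {n : ℕ} (hn : 2 ^ (n + 2) * δ ≤ 1 / 8)
    {x : X} {y w : Y} (hy : T x y) (hw : T ((1 / 2 : ℝ) • x) w) :
    ‖w - (1 / 2 : ℝ) • y‖ ≤ 1 / 2 ^ n + (n + 3) * δ := by
  obtain ⟨c, hc⟩ := h.exists_right 0 (by simp)
  have hδ := h.nonneg
  have hcδ := h.norm_le_of_zero hc
  have hx := h.norm_left_le hy
  have h2n : (1 : ℝ) ≤ 2 ^ n := one_le_pow₀ (by norm_num)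
  have hδ' : δ ≤ 1 / 8 := by rw [pow_succ, pow_succ] at hn; nlinarith
  -- With foci 0 and x, nearly the full ball is available: only the δ by which the partner c of 0
  -- may be off centre is lost.
  have hl := h.isLensCorrespondence hc hy (R := 1 - δ) (by simpa using hδ) (by linarith)
  have h1 := hl.norm_sub_midpoint_le n (by rw [zero_sub, norm_neg]; linarith) (w := w)
    (by simpa using hw)
  rw [zero_sub, norm_neg] at h1
  have h2 : ‖x‖ / 2 ^ (n + 1) ≤ 1 / 2 ^ n := by
    rw [pow_succ]
    gcongr
    linarith
  have h3 : w - (1 / 2 : ℝ) • y = (w - (1 / 2 : ℝ) • (c + y)) + (1 / 2 : ℝ) • c := by module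
  have h4 : ‖(1 / 2 : ℝ) • c‖ ≤ δ := by rw [norm_smul]; norm_num; linarith
  rw [h3]
  linarith [norm_add_le (w - (1 / 2 : ℝ) • (c + y)) ((1 / 2 : ℝ) • c)]

/-- Near the origin the lens of radius 1/2 about the two points stays inside the ball; for points
near the sphere it might not. General pairs are reduced to this case by halving twice. -/
theorem norm_sub_midpoint_le_of_small (h : IsBallCorrespondence T δ) {n : ℕ}
    (hn : 2 ^ (n + 2) * δ ≤ 1 / 8) {a b : X} {c d w : Y} (ha : ‖a‖ ≤ 1 / 4) (hb : ‖b‖ ≤ 1 / 4)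
    (hac : T a c) (hbd : T b d) (hw : T ((1 / 2 : ℝ) • (a + b)) w) :
    ‖w - (1 / 2 : ℝ) • (c + d)‖ ≤ 1 / 2 ^ n + (n + 3) * δ := by
  have hδ := h.nonneg
  have h2n : (1 : ℝ) ≤ 2 ^ n := one_le_pow₀ (by norm_num)
  have hδ' : δ ≤ 1 / 32 := by rw [pow_succ, pow_succ] at hn; nlinarith
  have hc := abs_le.1 (h.abs_norm_sub_norm_le hac)
  have hl := h.isLensCorrespondence hac hbd (R := 1 / 2) (by linarith) (by linarith)
  have hab := norm_sub_le a b
  have h1 := hl.norm_sub_midpoint_le n (by linarith) hw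
  have h2 : ‖a - b‖ / 2 ^ (n + 1) ≤ 1 / 2 ^ n := by
    rw [pow_succ]
    gcongr <;> linarith
  linarith

theorem norm_sub_four_smul_le (h : IsBallCorrespondence T δ) {n : ℕ}
    (hn : 2 ^ (n + 2) * δ ≤ 1 / 8) {x : X} {y w : Y} (hy : T x y) (hw : T ((1 / 4 : ℝ) • x) w) :
    ‖y - (4 : ℝ) • w‖ ≤ 6 * (1 / 2 ^ n + (n + 3) * δ) := by
  have hx := h.norm_left_le hy
  obtain ⟨z, hz⟩ := h.exists_right ((1 / 2 : ℝ) • x) (by rw [norm_smul]; norm_num; linarith)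
  have h1 := h.norm_sub_half_le hn hy hz
  have h2 := h.norm_sub_half_le hn hz (w := w) (by rw [smul_smul]; norm_num; simpa using hw)
  have h3 : y - (4 : ℝ) • w =
      (-2 : ℝ) • (z - (1 / 2 : ℝ) • y) + (-4 : ℝ) • (w - (1 / 2 : ℝ) • z) := by module
  rw [h3]
  refine (norm_add_le _ _).trans ?_
  rw [norm_smul, norm_smul]
  norm_num at h1 h2 ⊢
  linarith

theorem isApproxAffine (h : IsBallCorrespondence T δ) {n : ℕ}
    (hn : 2 ^ (n + 2) * δ ≤ 1 / 8) : IsApproxAffine T (16 * (1 / 2 ^ n + (n + 3) * δ)) := by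
  have hδ := h.nonneg
  refine ⟨⟨h.norm_left_le, h.norm_right_le, h.exists_right, h.exists_left, fun h1 h2 =>
    (h.distortion h1 h2).trans ?_⟩, ?_⟩
  · have : (0 : ℝ) ≤ 1 / 2 ^ n := by positivity
    nlinarith
  · intro a b c d w hac hbd hw
    have key : ∀ x : X, ‖x‖ ≤ 1 → ‖(1 / 4 : ℝ) • x‖ ≤ 1 / 4 := by
      intro x hx
      rw [norm_smul]; norm_num; exact hx
    have ha := key a (h.norm_left_le hac)
    have hb := key b (h.norm_left_le hbd)
    have hm := key _ (h.norm_left_le hw)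
    obtain ⟨c', hc'⟩ := h.exists_right _ (ha.trans (by norm_num))
    obtain ⟨d', hd'⟩ := h.exists_right _ (hb.trans (by norm_num))
    obtain ⟨w', hw'⟩ := h.exists_right _ (hm.trans (by norm_num))
    have h1 := h.norm_sub_four_smul_le hn hac hc'
    have h2 := h.norm_sub_four_smul_le hn hbd hd'
    have h3 := h.norm_sub_four_smul_le hn hw hw'
    have h4 := h.norm_sub_midpoint_le_of_small hn ha hb hc' hd' (w := w')
      (by rwa [← smul_add, smul_comm])
    -- The factor 16 is 6 + 4 + 6/2 + 6/2, in the order of the terms.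
    have h5 : w - (1 / 2 : ℝ) • (c + d) = (w - (4 : ℝ) • w')
        + (4 : ℝ) • (w' - (1 / 2 : ℝ) • (c' + d'))
        + ((-1 / 2 : ℝ) • (c - (4 : ℝ) • c') + (-1 / 2 : ℝ) • (d - (4 : ℝ) • d')) := by module
    rw [h5]
    have h6 := norm_add₃_le (a := w - (4 : ℝ) • w') (b := (4 : ℝ) • (w' - (1 / 2 : ℝ) • (c' + d')))
      (c := ((-1 / 2 : ℝ) • (c - (4 : ℝ) • c') + (-1 / 2 : ℝ) • (d - (4 : ℝ) • d')))
    have h7 := norm_add_le ((-1 / 2 : ℝ) • (c - (4 : ℝ) • c')) ((-1 / 2 : ℝ) • (d - (4 : ℝ) • d'))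
    rw [norm_smul] at h6
    rw [norm_smul, norm_smul] at h7
    norm_num at h1 h2 h3 h4 h6 h7 ⊢
    linarith

end IsBallCorrespondence

end BallCorrespondence

/-! ### The almost additive homogeneous extension. -/

section HomogeneousExtension

variable {X : Type u} {Y : Type v} [NormedAddCommGroup X] [NormedSpace ℝ X]
  [NormedAddCommGroup Y] [NormedSpace ℝ Y]

theorem norm_inv_norm_smul_le_one (x : X) : ‖‖x‖⁻¹ • x‖ ≤ 1 := by
  rw [norm_smul, norm_inv, norm_norm]; exact inv_mul_le_one

namespace IsApproxAffine

variable {T : X → Y → Prop} {θ : ℝ}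

/-- Binary expansion of t: t • x is the midpoint of 0 or x with a point (2t) • x or (2t - 1) • x.
Each step halves the previous error and adds at most 3θ/2, so 4θ absorbs all the steps. -/
theorem norm_sub_smul_le_aux (h : IsApproxAffine T θ) {x : X} {y : Y} (hy : T x y) (k : ℕ) :
    ∀ {t : ℝ} {w : Y}, 0 ≤ t → t ≤ 1 → T (t • x) w → ‖w - t • y‖ ≤ 2 / 2 ^ k + 4 * θ := by
  have hθ := h.nonneg
  have hy1 := h.norm_right_le hy
  obtain ⟨c, hc⟩ := h.exists_right 0 (by simp)
  have hcθ := h.norm_le_of_zero hc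
  induction k with
  | zero =>
    intro t w h0 h1 hw
    have h2 := norm_sub_le w (t • y)
    rw [norm_smul, Real.norm_of_nonneg h0] at h2
    have h3 := h.norm_right_le hw
    have h4 : t * ‖y‖ ≤ 1 := mul_le_one₀ h1 (norm_nonneg _) hy1
    simp only [pow_zero, div_one]
    linarith
  | succ k ih =>
    intro t w h0 h1 hw
    have hk : (2 : ℝ) / 2 ^ (k + 1) = 2 / 2 ^ k / 2 := by rw [pow_succ, div_div]
    rw [hk]
    rcases le_total t (1 / 2) with ht | ht
    · obtain ⟨z, hz⟩ := h.exists_right ((2 * t) • x) (by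
        rw [norm_smul, Real.norm_of_nonneg (by linarith)]
        exact mul_le_one₀ (by linarith) (norm_nonneg _) (h.norm_left_le hy))
      have h2 := ih (by linarith) (by linarith) hz
      have h3 := h.norm_sub_midpoint_le hc hz (w := w) (by
        rw [zero_add, smul_smul]; convert hw using 2; ring)
      have h4 : w - t • y = (w - (1 / 2 : ℝ) • (c + z)) + (1 / 2 : ℝ) • c
          + (1 / 2 : ℝ) • (z - (2 * t) • y) := by module
      rw [h4]
      have h5 := norm_add₃_le (a := w - (1 / 2 : ℝ) • (c + z)) (b := (1 / 2 : ℝ) • c)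
        (c := (1 / 2 : ℝ) • (z - (2 * t) • y))
      rw [norm_smul, norm_smul, Real.norm_of_nonneg (by norm_num)] at h5
      linarith
    · obtain ⟨z, hz⟩ := h.exists_right ((2 * t - 1) • x) (by
        rw [norm_smul, Real.norm_of_nonneg (by linarith)]
        exact mul_le_one₀ (by linarith) (norm_nonneg _) (h.norm_left_le hy))
      have h2 := ih (by linarith) (by linarith) hz
      have h3 := h.norm_sub_midpoint_le hy hz (w := w) (by
        convert hw using 1; module)
      have h4 : w - t • y = (w - (1 / 2 : ℝ) • (y + z))
          + (1 / 2 : ℝ) • (z - (2 * t - 1) • y) := by module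
      rw [h4]
      have h5 := norm_add_le (w - (1 / 2 : ℝ) • (y + z)) ((1 / 2 : ℝ) • (z - (2 * t - 1) • y))
      rw [norm_smul, Real.norm_of_nonneg (by norm_num)] at h5
      linarith

theorem norm_sub_smul_le (h : IsApproxAffine T θ) {x : X} {y w : Y} {t : ℝ} (hy : T x y)
    (h0 : 0 ≤ t) (h1 : t ≤ 1) (hw : T (t • x) w) : ‖w - t • y‖ ≤ 4 * θ := by
  have hlim : Tendsto (fun k : ℕ => (2 : ℝ) / 2 ^ k + 4 * θ) atTop (𝓝 (0 + 4 * θ)) := by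
    refine Tendsto.add_const _ ?_
    exact tendsto_const_nhds.div_atTop (tendsto_pow_atTop_atTop_of_one_lt (by norm_num))
  rw [zero_add] at hlim
  exact ge_of_tendsto' hlim fun k => h.norm_sub_smul_le_aux hy k h0 h1 hw

theorem norm_add_le_of_neg (h : IsApproxAffine T θ) {x : X} {y w : Y} (hy : T x y)
    (hw : T (-x) w) : ‖y + w‖ ≤ 4 * θ := by
  obtain ⟨c, hc⟩ := h.exists_right 0 (by simp)
  have hcθ := h.norm_le_of_zero hc
  have h1 := h.norm_sub_midpoint_le hy hw (w := c) (by simpa using hc)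
  have h2 : y + w = (2 : ℝ) • c - (2 : ℝ) • (c - (1 / 2 : ℝ) • (y + w)) := by module
  rw [h2]
  refine (norm_sub_le _ _).trans ?_
  rw [norm_smul, norm_smul, Real.norm_of_nonneg (by norm_num)]
  linarith

/-- A positively homogeneous map selected, on the unit sphere, from the correspondence. -/
noncomputable def extension (h : IsApproxAffine T θ) (x : X) : Y :=
  ‖x‖ • (h.exists_right (‖x‖⁻¹ • x) (norm_inv_norm_smul_le_one x)).choose

theorem exists_extension_eq (h : IsApproxAffine T θ) (x : X) :
    ∃ y, T (‖x‖⁻¹ • x) y ∧ h.extension x = ‖x‖ • y :=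
  ⟨_, (h.exists_right _ (norm_inv_norm_smul_le_one x)).choose_spec, rfl⟩

theorem extension_zero (h : IsApproxAffine T θ) : h.extension 0 = 0 := by
  simp [extension]

/-- The extension may be computed at any scale s ≥ ‖x‖ instead of ‖x‖, so vectors of different norms
can be compared at one scale. -/
theorem norm_extension_sub_smul_le (h : IsApproxAffine T θ) {x : X} {s : ℝ} (hs : 0 < s)
    (hx : ‖x‖ ≤ s) {y : Y} (hy : T (s⁻¹ • x) y) : ‖h.extension x - s • y‖ ≤ 4 * θ * s := by
  obtain ⟨z, hz, hxz⟩ := h.exists_extension_eq x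
  have h1 := h.norm_sub_smul_le hz (t := ‖x‖ / s) (w := y) (by positivity)
    ((div_le_one hs).2 hx) (by
      convert hy using 1
      rcases eq_or_ne x 0 with rfl | hx0
      · simp
      · rw [smul_smul]
        congr 1
        have := norm_ne_zero_iff.2 hx0
        field_simp)
  have h2 : h.extension x - s • y = -(s • (y - (‖x‖ / s) • z)) := by
    rw [hxz, smul_sub, smul_smul, mul_div_cancel₀ _ hs.ne', neg_sub]
  rw [h2, norm_neg, norm_smul, Real.norm_of_nonneg hs.le]
  nlinarith

theorem norm_le_norm_extension (h : IsApproxAffine T θ) (x : X) :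
    ‖x‖ ≤ ‖h.extension x‖ + 2 * θ * ‖x‖ := by
  rcases eq_or_ne x 0 with rfl | hx0
  · simp [extension_zero]
  obtain ⟨z, hz, hxz⟩ := h.exists_extension_eq x
  have h1 := (abs_le.1 (h.abs_norm_sub_norm_le hz)).2
  have hn : ‖x‖ ≠ 0 := norm_ne_zero_iff.2 hx0
  rw [norm_smul, norm_inv, norm_norm, inv_mul_cancel₀ hn] at h1
  rw [hxz, norm_smul, norm_norm]
  nlinarith [norm_nonneg x]

theorem norm_extension_smul_sub_le (h : IsApproxAffine T θ) {x : X} {y : Y} (hy : T x y) (c : ℝ) :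
    ‖h.extension (c • x) - c • y‖ ≤ 8 * θ * |c| := by
  have hθ := h.nonneg
  have hx := h.norm_left_le hy
  have hcx : ‖c • x‖ ≤ |c| := by
    rw [norm_smul, Real.norm_eq_abs]
    exact mul_le_of_le_one_right (abs_nonneg c) hx
  rcases lt_trichotomy c 0 with hc | rfl | hc
  · obtain ⟨w, hw⟩ := h.exists_right (-x) (by rwa [norm_neg])
    have h1 := h.norm_extension_sub_smul_le (abs_pos.2 hc.ne) hcx (y := w) (by
      rw [abs_of_neg hc, smul_smul, inv_neg, neg_mul, inv_mul_cancel₀ hc.ne, neg_one_smul]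
      exact hw)
    have h2 := h.norm_add_le_of_neg hy hw
    have h3 : h.extension (c • x) - c • y = (h.extension (c • x) - |c| • w) + |c| • (y + w) := by
      rw [abs_of_neg hc]; module
    rw [h3]
    refine (norm_add_le _ _).trans ?_
    rw [norm_smul, Real.norm_eq_abs, abs_abs]
    nlinarith [abs_nonneg c]
  · simp [extension_zero]
  · rw [abs_of_pos hc] at hcx ⊢
    have h1 := h.norm_extension_sub_smul_le hc hcx (y := y) (by
      rwa [smul_smul, inv_mul_cancel₀ hc.ne', one_smul])
    nlinarith

theorem norm_extension_add_sub_le (h : IsApproxAffine T θ) {x y : X} {s : ℝ} (hs : 0 < s)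
    (hx : ‖x‖ ≤ s) (hy : ‖y‖ ≤ s) :
    ‖h.extension (x + y) - h.extension x - h.extension y‖ ≤ 18 * θ * s := by
  have key : ∀ z : X, ‖z‖ ≤ s → ‖s⁻¹ • z‖ ≤ 1 := fun z hz => by
    rw [norm_smul, norm_inv, Real.norm_of_nonneg hs.le]
    exact inv_mul_le_one_of_le₀ hz hs.le
  have hm : ‖(1 / 2 : ℝ) • (x + y)‖ ≤ s := by
    rw [norm_smul]; norm_num; linarith [norm_add_le x y]
  obtain ⟨x', hx'⟩ := h.exists_right _ (key x hx)
  obtain ⟨y', hy'⟩ := h.exists_right _ (key y hy)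
  obtain ⟨w, hw⟩ := h.exists_right _ (key _ hm)
  have h1 := h.norm_extension_sub_smul_le hs hx hx'
  have h2 := h.norm_extension_sub_smul_le hs hy hy'
  -- At scale 2s the normalized sum is the midpoint of the normalized summands. The constant is 18 =
  -- 8 + 4 + 4 + 2.
  have h3 := h.norm_extension_sub_smul_le (x := x + y) (s := 2 * s) (by linarith)
    (by linarith [norm_add_le x y]) (y := w) (by
      convert hw using 1; rw [smul_smul]; congr 1; field_simp)
  have h4 := h.norm_sub_midpoint_le hx' hy' (w := w) (by rwa [← smul_add, smul_comm])
  have h5 : h.extension (x + y) - h.extension x - h.extension y =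
      (h.extension (x + y) - (2 * s) • w) - (h.extension x - s • x') - (h.extension y - s • y')
      + (2 * s) • (w - (1 / 2 : ℝ) • (x' + y')) := by module
  rw [h5]
  refine (norm_add_le _ _).trans ?_
  have h6 := norm_sub_le ((h.extension (x + y) - (2 * s) • w) - (h.extension x - s • x'))
    (h.extension y - s • y')
  have h7 := norm_sub_le (h.extension (x + y) - (2 * s) • w) (h.extension x - s • x')
  rw [norm_smul, Real.norm_of_nonneg (by linarith)]
  nlinarith

theorem norm_extension_add_add_sub_le (h : IsApproxAffine T θ) {x y z : X} {s : ℝ} (hs : 0 ≤ s)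
    (hx : ‖x‖ ≤ s) (hy : ‖y‖ ≤ s) (hz : ‖z‖ ≤ s) :
    ‖h.extension (x + y + z) - h.extension x - h.extension y - h.extension z‖ ≤ 54 * θ * s := by
  have hθ := h.nonneg
  rcases hs.eq_or_lt with rfl | hs
  · rw [norm_le_zero_iff] at hx hy hz
    simp [hx, hy, hz, h.extension_zero]
  have h1 := h.norm_extension_add_sub_le hs hx hy
  have h2 := h.norm_extension_add_sub_le (x := x + y) (y := z) (s := 2 * s) (by linarith)
    (by linarith [norm_add_le x y]) (by linarith)
  have h3 : h.extension (x + y + z) - h.extension x - h.extension y - h.extension z =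
    (h.extension (x + y + z) - h.extension (x + y) - h.extension z)
    + (h.extension (x + y) - h.extension x - h.extension y) := by abel
  rw [h3]
  linarith [norm_add_le (h.extension (x + y + z) - h.extension (x + y) - h.extension z)
    (h.extension (x + y) - h.extension x - h.extension y)]

end IsApproxAffine

end HomogeneousExtension

/-! ### Length-independent estimates for linear combinations. -/

section Combinations

/-- The entry e is the one at which the partial sums reach τ. -/
theorem List.exists_balanced_split {α : Type*} (f : α → ℝ) (l : List α) :
    ∀ τ : ℝ, 0 ≤ τ → τ ≤ (l.map f).sum → l ≠ [] →
      ∃ p e q, l = p ++ e :: q ∧ (p.map f).sum ≤ τ ∧ (q.map f).sum ≤ (l.map f).sum - τ := by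
  induction l with
  | nil => intro τ _ _ h; exact absurd rfl h
  | cons a l ih =>
    intro τ h0 h1 _
    rw [List.map_cons, List.sum_cons] at h1
    rcases le_or_gt τ (f a) with ha | ha
    · refine ⟨[], a, l, rfl, by simpa using h0, ?_⟩
      rw [List.map_cons, List.sum_cons]; linarith
    · have hl : l ≠ [] := by
        rintro rfl
        simp at h1; linarith
      obtain ⟨p, e, q, rfl, hp, hq⟩ := ih (τ - f a) (by linarith) (by linarith) hl
      refine ⟨a :: p, e, q, rfl, ?_, ?_⟩
      · rw [List.map_cons, List.sum_cons]; linarith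
      · rw [List.map_cons, List.sum_cons]; linarith

/-- `∑ |c| ^ r` over a list of triples `(c, x, y)`. -/
noncomputable def coeffSum {X : Type u} {Y : Type v} (r : ℝ) (l : List (ℝ × X × Y)) : ℝ :=
  (l.map fun e => |e.1| ^ r).sum

variable {X : Type u} {Y : Type v} [NormedAddCommGroup X] [NormedSpace ℝ X]
  [NormedAddCommGroup Y] [NormedSpace ℝ Y] {r : ℝ}

/-- `∑ c • x` over a list of triples `(c, x, y)`. -/
def fstCombination (l : List (ℝ × X × Y)) : X := (l.map fun e => e.1 • e.2.1).sum

/-- `∑ c • y` over a list of triples `(c, x, y)`. -/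
def sndCombination (l : List (ℝ × X × Y)) : Y := (l.map fun e => e.1 • e.2.2).sum

@[simp] theorem coeffSum_nil : coeffSum r ([] : List (ℝ × X × Y)) = 0 := rfl

@[simp] theorem coeffSum_cons (e : ℝ × X × Y) (l : List (ℝ × X × Y)) :
    coeffSum r (e :: l) = |e.1| ^ r + coeffSum r l := by simp [coeffSum]

@[simp] theorem coeffSum_append (l l' : List (ℝ × X × Y)) :
    coeffSum r (l ++ l') = coeffSum r l + coeffSum r l' := by simp [coeffSum]

@[simp] theorem fstCombination_nil : fstCombination ([] : List (ℝ × X × Y)) = 0 := rfl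

@[simp] theorem fstCombination_cons (e : ℝ × X × Y) (l : List (ℝ × X × Y)) :
    fstCombination (e :: l) = e.1 • e.2.1 + fstCombination l := by simp [fstCombination]

@[simp] theorem fstCombination_append (l l' : List (ℝ × X × Y)) :
    fstCombination (l ++ l') = fstCombination l + fstCombination l' := by simp [fstCombination]

@[simp] theorem sndCombination_nil : sndCombination ([] : List (ℝ × X × Y)) = 0 := rfl

@[simp] theorem sndCombination_cons (e : ℝ × X × Y) (l : List (ℝ × X × Y)) :
    sndCombination (e :: l) = e.1 • e.2.2 + sndCombination l := by simp [sndCombination]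

@[simp] theorem sndCombination_append (l l' : List (ℝ × X × Y)) :
    sndCombination (l ++ l') = sndCombination l + sndCombination l' := by simp [sndCombination]

theorem coeffSum_nonneg (l : List (ℝ × X × Y)) : 0 ≤ coeffSum r l :=
  List.sum_nonneg (by simp only [List.mem_map]; rintro _ ⟨e, -, rfl⟩; positivity)

theorem norm_add_rpow_le {E : Type*} [SeminormedAddCommGroup E] (hr0 : 0 < r) (hr1 : r ≤ 1)
    (x y : E) : ‖x + y‖ ^ r ≤ ‖x‖ ^ r + ‖y‖ ^ r :=
  (Real.rpow_le_rpow (norm_nonneg _) (norm_add_le x y) hr0.le).trans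
    (Real.rpow_add_le_add_rpow (norm_nonneg _) (norm_nonneg _) hr0.le hr1)

theorem norm_fstCombination_rpow_le (hr0 : 0 < r) (hr1 : r ≤ 1) (l : List (ℝ × X × Y))
    (hl : ∀ e ∈ l, ‖e.2.1‖ ≤ 1) : ‖fstCombination l‖ ^ r ≤ coeffSum r l := by
  induction l with
  | nil => simp [Real.zero_rpow hr0.ne']
  | cons e l ih =>
    rw [fstCombination_cons, coeffSum_cons]
    refine (norm_add_rpow_le hr0 hr1 _ _).trans (add_le_add ?_
      (ih fun e he => hl e (List.mem_cons_of_mem _ he)))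
    refine Real.rpow_le_rpow (norm_nonneg _) ?_ hr0.le
    rw [norm_smul, Real.norm_eq_abs]
    exact mul_le_of_le_one_right (abs_nonneg _) (hl e List.mem_cons_self)

theorem norm_fstCombination_le (hr0 : 0 < r) (hr1 : r ≤ 1) (l : List (ℝ × X × Y))
    (hl : ∀ e ∈ l, ‖e.2.1‖ ≤ 1) : ‖fstCombination l‖ ≤ coeffSum r l ^ (1 / r) := by
  rw [one_div]
  exact (Real.le_rpow_inv_iff_of_pos (norm_nonneg _) (coeffSum_nonneg l) hr0).2
    (norm_fstCombination_rpow_le hr0 hr1 l hl)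

theorem rpow_add_rpow_le_of_le_half (hr0 : 0 < r) {a b s : ℝ} (ha : 0 ≤ a)
    (hb : 0 ≤ b) (has : a ≤ s / 2) (hbs : b ≤ s / 2) :
    a ^ (1 / r) + b ^ (1 / r) ≤ 2 ^ (1 - 1 / r) * s ^ (1 / r) := by
  have hr : 0 ≤ 1 / r := by positivity
  have hs : 0 ≤ s := by linarith
  have h1 := Real.rpow_le_rpow ha has hr
  have h2 := Real.rpow_le_rpow hb hbs hr
  have h3 : (2 : ℝ) ^ (1 - 1 / r) * s ^ (1 / r) = 2 * (s / 2) ^ (1 / r) := by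
    rw [Real.div_rpow hs (by norm_num), Real.rpow_sub (by norm_num), Real.rpow_one]
    ring
  rw [h3]; linarith

theorem two_rpow_one_sub_lt_one (hr0 : 0 < r) (hr1 : r < 1) : (2 : ℝ) ^ (1 - 1 / r) < 1 :=
  Real.rpow_lt_one_of_one_lt_of_neg (by norm_num) (by rw [sub_neg]; exact one_lt_one_div hr0 hr1)

/-- Remove an entry e such that the parts p and q on either side carry at most half the r-weight S.
Recombining three vectors costs 54θ S^(1/r) and the single term 8θ S^(1/r), while the errors of the
shorter lists p and q contract by ρ. -/
theorem IsApproxAffine.norm_extension_fstCombination_sub_le {T : X → Y → Prop} {θ : ℝ}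
    (h : IsApproxAffine T θ) (hr0 : 0 < r) (hr1 : r < 1) (n : ℕ) : ∀ l : List (ℝ × X × Y),
    l.length ≤ n → (∀ e ∈ l, T e.2.1 e.2.2) →
    ‖h.extension (fstCombination l) - sndCombination l‖ ≤
      62 * θ / (1 - 2 ^ (1 - 1 / r)) * coeffSum r l ^ (1 / r) := by
  have hθ := h.nonneg
  have hρ := two_rpow_one_sub_lt_one hr0 hr1
  set ρ : ℝ := 2 ^ (1 - 1 / r) with hρdef
  set A : ℝ := 62 * θ / (1 - ρ) with hA
  have hA0 : 0 ≤ A := div_nonneg (by positivity) (by linarith)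
  -- A is the fixed point of the recursion for the error constant.
  have hAρ : A * ρ + 62 * θ = A := by
    have : A * (1 - ρ) = 62 * θ := div_mul_cancel₀ _ (by linarith)
    linarith
  induction n with
  | zero =>
    intro l hl _
    rw [List.length_eq_zero_iff.1 (Nat.le_zero.1 hl)]
    simp [h.extension_zero, Real.zero_rpow (inv_ne_zero hr0.ne')]
  | succ n ih =>
    intro l hl hT
    have hS := coeffSum_nonneg (r := r) l
    rcases eq_or_ne l [] with rfl | hne
    · exact ih [] (by simp) hT
    have hX : ∀ e ∈ l, ‖e.2.1‖ ≤ 1 := fun e he => h.norm_left_le (hT e he)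
    obtain ⟨p, e, q, rfl, hp, hq⟩ := List.exists_balanced_split (fun e : ℝ × X × Y => |e.1| ^ r)
      l (coeffSum r l / 2) (by linarith)
      (by change _ ≤ coeffSum r l; linarith) hne
    set S := coeffSum r (p ++ e :: q) with hSdef
    change coeffSum r p ≤ _ at hp
    change coeffSum r q ≤ S - _ at hq
    have hSe : S = coeffSum r p + (|e.1| ^ r + coeffSum r q) := by simp [hSdef]
    have hp0 := coeffSum_nonneg (r := r) p
    have hq0 := coeffSum_nonneg (r := r) q
    have hlen : p.length + (q.length + 1) ≤ n + 1 := by simpa using hl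
    have ihp := ih p (by omega) fun e he => hT e (by simp [he])
    have ihq := ih q (by omega) fun e he => hT e (by simp [he])
    have hTe := hT e (by simp)
    have hr : 0 ≤ 1 / r := by positivity
    have he0 : 0 ≤ |e.1| ^ r := by positivity
    have hes : |e.1| ≤ S ^ (1 / r) := by
      rw [one_div]
      exact (Real.le_rpow_inv_iff_of_pos (abs_nonneg _) hS hr0).2 (by linarith)
    have hps : ‖fstCombination p‖ ≤ S ^ (1 / r) :=
      (norm_fstCombination_le hr0 hr1.le p fun e he => hX e (by simp [he])).trans
        (Real.rpow_le_rpow hp0 (by linarith) hr)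
    have hqs : ‖fstCombination q‖ ≤ S ^ (1 / r) :=
      (norm_fstCombination_le hr0 hr1.le q fun e he => hX e (by simp [he])).trans
        (Real.rpow_le_rpow hq0 (by linarith) hr)
    have hexs : ‖e.1 • e.2.1‖ ≤ S ^ (1 / r) := by
      rw [norm_smul, Real.norm_eq_abs]
      exact (mul_le_of_le_one_right (abs_nonneg _) (hX e (by simp))).trans hes
    have hs : 0 ≤ S ^ (1 / r) := Real.rpow_nonneg hS _
    have h1 := h.norm_extension_add_add_sub_le hs hps hexs hqs
    have h2 := h.norm_extension_smul_sub_le hTe e.1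
    have h3 := rpow_add_rpow_le_of_le_half hr0 hp0 hq0 hp (by linarith : _ ≤ S / 2)
    rw [← hρdef] at h3
    have h4 : h.extension (fstCombination (p ++ e :: q)) - sndCombination (p ++ e :: q) =
        (h.extension (fstCombination p + e.1 • e.2.1 + fstCombination q)
          - h.extension (fstCombination p) - h.extension (e.1 • e.2.1)
          - h.extension (fstCombination q))
        + (h.extension (fstCombination p) - sndCombination p)
        + (h.extension (e.1 • e.2.1) - e.1 • e.2.2)
        + (h.extension (fstCombination q) - sndCombination q) := by
      simp only [fstCombination_append, fstCombination_cons, sndCombination_append,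
        sndCombination_cons, add_assoc]
      abel
    rw [h4]
    refine norm_add₄_le.trans ?_
    have h5 : 8 * θ * |e.1| ≤ 8 * θ * S ^ (1 / r) := by gcongr
    have h6 := mul_le_mul_of_nonneg_left h3 hA0
    have h7 : A * S ^ (1 / r) = A * ρ * S ^ (1 / r) + 62 * θ * S ^ (1 / r) := by
      rw [← add_mul, hAρ]
    rw [h7]
    linarith

end Combinations

/-! ### The r-normed sum in which related vectors are close. -/

section RNormSum

variable {X : Type u} {Y : Type v} [NormedAddCommGroup X] [NormedSpace ℝ X]
  [NormedAddCommGroup Y] [NormedSpace ℝ Y] {r τ : ℝ} {T : X → Y → Prop}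

/-- The exchange of the two vectors in every triple of a list. -/
def swapVectors (l : List (ℝ × X × Y)) : List (ℝ × Y × X) := l.map fun e => (e.1, e.2.swap)

/-- The multiplication of all coefficients of a list of triples by a constant. -/
def scaleCoeffs (a : ℝ) (l : List (ℝ × X × Y)) : List (ℝ × X × Y) := l.map fun e => (a * e.1, e.2)

theorem coeffSum_swapVectors (l : List (ℝ × X × Y)) :
    coeffSum r (swapVectors l) = coeffSum r l := by
  induction l with
  | nil => rfl
  | cons e l ih => simpa [swapVectors] using ih

theorem fstCombination_swapVectors (l : List (ℝ × X × Y)) :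
    fstCombination (swapVectors l) = sndCombination l := by
  induction l with
  | nil => rfl
  | cons e l ih => simpa [swapVectors] using ih

theorem sndCombination_swapVectors (l : List (ℝ × X × Y)) :
    sndCombination (swapVectors l) = fstCombination l := by
  induction l with
  | nil => rfl
  | cons e l ih => simpa [swapVectors] using ih

theorem coeffSum_scaleCoeffs (a : ℝ) (l : List (ℝ × X × Y)) :
    coeffSum r (scaleCoeffs a l) = |a| ^ r * coeffSum r l := by
  induction l with
  | nil => simp [scaleCoeffs]
  | cons e l ih =>
    have h : scaleCoeffs a (e :: l) = (a * e.1, e.2) :: scaleCoeffs a l := rfl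
    rw [h, coeffSum_cons, coeffSum_cons, ih, abs_mul,
      Real.mul_rpow (abs_nonneg _) (abs_nonneg _), mul_add]

theorem fstCombination_scaleCoeffs (a : ℝ) (l : List (ℝ × X × Y)) :
    fstCombination (scaleCoeffs a l) = a • fstCombination l := by
  induction l with
  | nil => simp [scaleCoeffs]
  | cons e l ih =>
    have h : scaleCoeffs a (e :: l) = (a * e.1, e.2) :: scaleCoeffs a l := rfl
    rw [h, fstCombination_cons, fstCombination_cons, ih, smul_add, mul_smul]

theorem sndCombination_scaleCoeffs (a : ℝ) (l : List (ℝ × X × Y)) :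
    sndCombination (scaleCoeffs a l) = a • sndCombination l := by
  induction l with
  | nil => simp [scaleCoeffs]
  | cons e l ih =>
    have h : scaleCoeffs a (e :: l) = (a * e.1, e.2) :: scaleCoeffs a l := rfl
    rw [h, sndCombination_cons, sndCombination_cons, ih, smul_add, mul_smul]

/-- The factor relating the approximate affinity of a correspondence to the distance of the balls
in the `r`-normed sum. -/
noncomputable def linkingConstant (r : ℝ) : ℝ := 62 / (1 - 2 ^ (1 - 1 / r)) + 2

theorem linkingConstant_pos (hr0 : 0 < r) (hr1 : r < 1) : 0 < linkingConstant r := by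
  have h := two_rpow_one_sub_lt_one hr0 hr1
  have : 0 < 62 / (1 - (2 : ℝ) ^ (1 - 1 / r)) := div_pos (by norm_num) (by linarith)
  unfold linkingConstant; linarith

theorem IsApproxAffine.norm_fstCombination_rpow_le_add {θ : ℝ} (h : IsApproxAffine T θ)
    (hr0 : 0 < r) (hr1 : r < 1) (l : List (ℝ × X × Y)) (hl : ∀ e ∈ l, T e.2.1 e.2.2) :
    ‖fstCombination l‖ ^ r ≤
      ‖sndCombination l‖ ^ r + (linkingConstant r * θ) ^ r * coeffSum r l := by
  have hθ := h.nonneg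
  have hS := coeffSum_nonneg (r := r) l
  have hs : 0 ≤ coeffSum r l ^ (1 / r) := Real.rpow_nonneg hS _
  have hτ : 0 ≤ linkingConstant r * θ := mul_nonneg (linkingConstant_pos hr0 hr1).le hθ
  have h1 := h.norm_extension_fstCombination_sub_le hr0 hr1 l.length l le_rfl hl
  have h2 := h.norm_le_norm_extension (fstCombination l)
  have h3 := norm_fstCombination_le hr0 hr1.le l fun e he => h.norm_left_le (hl e he)
  have h4 := norm_le_norm_add_norm_sub' (h.extension (fstCombination l)) (sndCombination l)
  have h5 : 2 * θ * ‖fstCombination l‖ ≤ 2 * θ * coeffSum r l ^ (1 / r) := by gcongr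
  have h6 : ‖fstCombination l‖ ≤
      ‖sndCombination l‖ + linkingConstant r * θ * coeffSum r l ^ (1 / r) := by
    have : linkingConstant r * θ * coeffSum r l ^ (1 / r) =
        62 * θ / (1 - 2 ^ (1 - 1 / r)) * coeffSum r l ^ (1 / r)
          + 2 * θ * coeffSum r l ^ (1 / r) := by
      unfold linkingConstant; ring
    linarith
  refine (Real.rpow_le_rpow (norm_nonneg _) h6 hr0.le).trans
    ((Real.rpow_add_le_add_rpow (norm_nonneg _) (mul_nonneg hτ hs) hr0.le hr1.le).trans_eq ?_)
  rw [Real.mul_rpow hτ hs, ← Real.rpow_mul hS, one_div_mul_cancel hr0.ne', Real.rpow_one]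

/-- A relation between the unit balls for which making related vectors `τ`-close is compatible with
the norms of `X` and `Y` in an `r`-normed sum. -/
structure IsLinking (T : X → Y → Prop) (r τ : ℝ) : Prop where
  pos : 0 < τ
  r_pos : 0 < r
  r_le_one : r ≤ 1
  norm_left_le : ∀ {x y}, T x y → ‖x‖ ≤ 1
  norm_right_le : ∀ {x y}, T x y → ‖y‖ ≤ 1
  fst_le : ∀ l : List (ℝ × X × Y), (∀ e ∈ l, T e.2.1 e.2.2) →
    ‖fstCombination l‖ ^ r ≤ ‖sndCombination l‖ ^ r + τ ^ r * coeffSum r l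
  snd_le : ∀ l : List (ℝ × X × Y), (∀ e ∈ l, T e.2.1 e.2.2) →
    ‖sndCombination l‖ ^ r ≤ ‖fstCombination l‖ ^ r + τ ^ r * coeffSum r l

theorem IsApproxAffine.isLinking {θ : ℝ} (h : IsApproxAffine T θ)
    (h' : IsApproxAffine (fun y x => T x y) θ) (hθ : 0 < θ) (hr0 : 0 < r) (hr1 : r < 1) :
    IsLinking T r (linkingConstant r * θ) := by
  refine ⟨mul_pos (linkingConstant_pos hr0 hr1) hθ, hr0, hr1.le, h.norm_left_le, h.norm_right_le,
    h.norm_fstCombination_rpow_le_add hr0 hr1, fun l hl => ?_⟩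
  have h1 := h'.norm_fstCombination_rpow_le_add hr0 hr1 (swapVectors l) (by
    intro e he
    obtain ⟨e', he', rfl⟩ := List.mem_map.1 he
    exact hl e' he')
  rwa [fstCombination_swapVectors, sndCombination_swapVectors, coeffSum_swapVectors] at h1

/-- The costs of the representations of `z` as a sum of a vector of `X`, a vector of `Y` and a
combination of differences of related vectors. -/
def linkedCosts (T : X → Y → Prop) (r τ : ℝ) (z : X × Y) : Set ℝ :=
  {t | ∃ (x : X) (y : Y) (l : List (ℝ × X × Y)), (∀ e ∈ l, T e.2.1 e.2.2) ∧
    z = (x + fstCombination l, y - sndCombination l) ∧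
    t = ‖x‖ ^ r + ‖y‖ ^ r + τ ^ r * coeffSum r l}

/-- The `r`-th power of the norm of the `r`-normed sum. -/
noncomputable def linkedGauge (T : X → Y → Prop) (r τ : ℝ) (z : X × Y) : ℝ :=
  sInf (linkedCosts T r τ z)

namespace IsLinking

theorem linkedCosts_nonneg (h : IsLinking T r τ) {z : X × Y} {t : ℝ}
    (ht : t ∈ linkedCosts T r τ z) : 0 ≤ t := by
  obtain ⟨x, y, l, -, -, rfl⟩ := ht
  have := coeffSum_nonneg (r := r) l
  have := h.pos
  positivity

theorem linkedGauge_le (h : IsLinking T r τ) {z : X × Y} {t : ℝ}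
    (ht : t ∈ linkedCosts T r τ z) : linkedGauge T r τ z ≤ t :=
  csInf_le ⟨0, fun _ => h.linkedCosts_nonneg⟩ ht

theorem norm_rpow_mem_linkedCosts (z : X × Y) :
    ‖z.1‖ ^ r + ‖z.2‖ ^ r ∈ linkedCosts T r τ z :=
  ⟨z.1, z.2, [], by simp, by simp, by simp⟩

theorem le_linkedGauge {z : X × Y} {b : ℝ} (hb : ∀ t ∈ linkedCosts T r τ z, b ≤ t) :
    b ≤ linkedGauge T r τ z :=
  le_csInf ⟨_, norm_rpow_mem_linkedCosts z⟩ hb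

theorem linkedGauge_nonneg (h : IsLinking T r τ) (z : X × Y) : 0 ≤ linkedGauge T r τ z :=
  le_linkedGauge fun _ => h.linkedCosts_nonneg

theorem linkedGauge_le_norm (h : IsLinking T r τ) (z : X × Y) :
    linkedGauge T r τ z ≤ 2 * ‖z‖ ^ r := by
  refine (h.linkedGauge_le (norm_rpow_mem_linkedCosts z)).trans ?_
  have h1 := Real.rpow_le_rpow (norm_nonneg _) (norm_fst_le z) h.r_pos.le
  have h2 := Real.rpow_le_rpow (norm_nonneg _) (norm_snd_le z) h.r_pos.le
  linarith

/-- Related vectors lie in the unit balls, so a link of coefficient c contributes at most |c|^r to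
either coordinate and costs τ^r |c|^r. Together with `linkedGauge_le_norm` this makes the gauge
equivalent to ‖z‖^r, which yields definiteness and completeness. -/
theorem norm_le_linkedGauge (h : IsLinking T r τ) (z : X × Y) :
    (min 1 τ) ^ r * ‖z‖ ^ r ≤ linkedGauge T r τ z := by
  refine le_linkedGauge ?_
  rintro _ ⟨x, y, l, hl, rfl, rfl⟩
  have hτ := h.pos
  have hm : 0 ≤ min 1 τ := le_min zero_le_one hτ.le
  have h1 : (min 1 τ) ^ r ≤ 1 := Real.rpow_le_one hm (min_le_left _ _) h.r_pos.le
  have h2 : (min 1 τ) ^ r ≤ τ ^ r := Real.rpow_le_rpow hm (min_le_right _ _) h.r_pos.le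
  have h0 : 0 ≤ (min 1 τ) ^ r := Real.rpow_nonneg hm _
  have hS := coeffSum_nonneg (r := r) l
  have hx := norm_add_rpow_le h.r_pos h.r_le_one x (fstCombination l)
  have hx' := norm_fstCombination_rpow_le h.r_pos h.r_le_one l
    fun e he => h.norm_left_le (hl e he)
  have hy := norm_add_rpow_le h.r_pos h.r_le_one y (-sndCombination l)
  rw [norm_neg, ← sub_eq_add_neg] at hy
  have hy' := norm_fstCombination_rpow_le h.r_pos h.r_le_one (swapVectors l) (by
    intro e he
    obtain ⟨e', he', rfl⟩ := List.mem_map.1 he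
    exact h.norm_right_le (hl e' he'))
  rw [fstCombination_swapVectors, coeffSum_swapVectors] at hy'
  have hx0 : 0 ≤ ‖x‖ ^ r := by positivity
  have hy0 : 0 ≤ ‖y‖ ^ r := by positivity
  have hz : ‖((x + fstCombination l, y - sndCombination l) : X × Y)‖ ^ r ≤
      ‖x‖ ^ r + ‖y‖ ^ r + coeffSum r l := by
    rw [Prod.norm_def]
    rcases max_choice ‖x + fstCombination l‖ ‖y - sndCombination l‖ with hc | hc
    · simp only [hc]; linarith
    · simp only [hc]; linarith
  nlinarith

theorem linkedGauge_add_le (h : IsLinking T r τ) (z w : X × Y) :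
    linkedGauge T r τ (z + w) ≤ linkedGauge T r τ z + linkedGauge T r τ w := by
  rw [← sub_le_iff_le_add]
  refine le_linkedGauge fun t ht => ?_
  rw [sub_le_comm]
  refine le_linkedGauge fun s hs => ?_
  rw [sub_le_iff_le_add]
  obtain ⟨x, y, l, hl, rfl, rfl⟩ := ht
  obtain ⟨x', y', l', hl', rfl, rfl⟩ := hs
  have h1 := h.linkedGauge_le (z := (x + fstCombination l, y - sndCombination l)
    + (x' + fstCombination l', y' - sndCombination l'))
    ⟨x + x', y + y', l ++ l', by
      intro e he
      rcases List.mem_append.1 he with he | he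
      exacts [hl e he, hl' e he], by
      ext
      · simp; abel
      · simp; abel, rfl⟩
  have h2 := norm_add_rpow_le h.r_pos h.r_le_one x x'
  have h3 := norm_add_rpow_le h.r_pos h.r_le_one y y'
  rw [coeffSum_append, mul_add] at h1
  linarith

theorem linkedGauge_smul_le (h : IsLinking T r τ) (a : ℝ) (z : X × Y) :
    linkedGauge T r τ (a • z) ≤ |a| ^ r * linkedGauge T r τ z := by
  rcases eq_or_ne a 0 with rfl | ha
  · rw [zero_smul, abs_zero, Real.zero_rpow h.r_pos.ne', zero_mul]
    simpa [Real.zero_rpow h.r_pos.ne'] using h.linkedGauge_le_norm 0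
  have hpos : 0 < |a| ^ r := Real.rpow_pos_of_pos (abs_pos.2 ha) _
  rw [← div_le_iff₀' hpos]
  refine le_linkedGauge fun t ht => ?_
  rw [div_le_iff₀' hpos]
  obtain ⟨x, y, l, hl, rfl, rfl⟩ := ht
  refine h.linkedGauge_le ⟨a • x, a • y, scaleCoeffs a l, ?_, ?_, ?_⟩
  · intro e he
    obtain ⟨e', he', rfl⟩ := List.mem_map.1 he
    exact hl e' he'
  · rw [fstCombination_scaleCoeffs, sndCombination_scaleCoeffs, Prod.smul_mk, smul_add, smul_sub]
  · rw [coeffSum_scaleCoeffs, norm_smul, norm_smul, Real.norm_eq_abs,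
      Real.mul_rpow (abs_nonneg _) (norm_nonneg _), Real.mul_rpow (abs_nonneg _) (norm_nonneg _)]
    ring

theorem linkedGauge_smul (h : IsLinking T r τ) (a : ℝ) (z : X × Y) :
    linkedGauge T r τ (a • z) = |a| ^ r * linkedGauge T r τ z := by
  refine le_antisymm (h.linkedGauge_smul_le a z) ?_
  rcases eq_or_ne a 0 with rfl | ha
  · rw [abs_zero, Real.zero_rpow h.r_pos.ne', zero_mul]
    exact h.linkedGauge_nonneg _
  have h1 := h.linkedGauge_smul_le a⁻¹ (a • z)
  rw [smul_smul, inv_mul_cancel₀ ha, one_smul, abs_inv, Real.inv_rpow (abs_nonneg _)] at h1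
  rwa [← le_inv_mul_iff₀ (Real.rpow_pos_of_pos (abs_pos.2 ha) _)]

/-- In a representation of (x, 0) the Y-part must cancel the links, so it equals ∑ c • y; by
`fst_le`, its cost and that of the links pay for ∑ c • x. -/
theorem linkedGauge_left (h : IsLinking T r τ) (x : X) : linkedGauge T r τ (x, 0) = ‖x‖ ^ r := by
  refine le_antisymm ((h.linkedGauge_le (norm_rpow_mem_linkedCosts _)).trans_eq ?_)
    (le_linkedGauge ?_)
  · simp [Real.zero_rpow h.r_pos.ne']
  · rintro _ ⟨x', y', l, hl, hz, rfl⟩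
    obtain ⟨rfl, hy⟩ := Prod.mk.inj hz
    rw [sub_eq_zero.1 hy.symm]
    linarith [norm_add_rpow_le h.r_pos h.r_le_one x' (fstCombination l), h.fst_le l hl]

theorem linkedGauge_right (h : IsLinking T r τ) (y : Y) : linkedGauge T r τ (0, y) = ‖y‖ ^ r := by
  refine le_antisymm ((h.linkedGauge_le (norm_rpow_mem_linkedCosts _)).trans_eq ?_)
    (le_linkedGauge ?_)
  · simp [Real.zero_rpow h.r_pos.ne']
  · rintro _ ⟨x', y', l, hl, hz, rfl⟩
    obtain ⟨hx, rfl⟩ := Prod.mk.inj hz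
    have h1 := norm_add_rpow_le h.r_pos h.r_le_one y' (-sndCombination l)
    rw [norm_neg, ← sub_eq_add_neg] at h1
    rw [eq_neg_of_add_eq_zero_left hx.symm, norm_neg]
    linarith [h.snd_le l hl]

theorem linkedGauge_link (h : IsLinking T r τ) {x : X} {y : Y} (hxy : T x y) :
    linkedGauge T r τ (x, -y) ≤ τ ^ r :=
  h.linkedGauge_le ⟨0, 0, [(1, x, y)], by simpa using hxy, by simp,
    by simp [Real.zero_rpow h.r_pos.ne']⟩

/-- The `r`-norm of the `r`-normed sum of `X` and `Y` in which related vectors are `τ`-close. -/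
noncomputable def rNorm (h : IsLinking T r τ) : RNorm r (X × Y) where
  toFun z := linkedGauge T r τ z ^ (1 / r)
  pos_of_ne_zero z hz := by
    refine Real.rpow_pos_of_pos (lt_of_lt_of_le ?_ (h.norm_le_linkedGauge z)) _
    have h1 : 0 < ‖z‖ := norm_pos_iff.2 hz
    have h2 : 0 < min 1 τ := lt_min zero_lt_one h.pos
    positivity
  smul_eq a z := by
    rw [h.linkedGauge_smul, Real.mul_rpow (by positivity) (h.linkedGauge_nonneg z),
      ← Real.rpow_mul (abs_nonneg a), mul_one_div_cancel h.r_pos.ne', Real.rpow_one]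
  add_rpow_le z w := by
    simp only [← Real.rpow_mul (h.linkedGauge_nonneg _), one_div_mul_cancel h.r_pos.ne',
      Real.rpow_one]
    exact h.linkedGauge_add_le z w

theorem rNorm_rpow (h : IsLinking T r τ) (z : X × Y) :
    h.rNorm.toFun z ^ r = linkedGauge T r τ z := by
  change (linkedGauge T r τ z ^ (1 / r)) ^ r = _
  rw [← Real.rpow_mul (h.linkedGauge_nonneg _), one_div_mul_cancel h.r_pos.ne', Real.rpow_one]

theorem rNorm_eq_of_linkedGauge_eq (h : IsLinking T r τ) {z : X × Y} {a : ℝ} (ha : 0 ≤ a)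
    (hz : linkedGauge T r τ z = a ^ r) : h.rNorm.toFun z = a := by
  change linkedGauge T r τ z ^ (1 / r) = _
  rw [hz, ← Real.rpow_mul ha, mul_one_div_cancel h.r_pos.ne', Real.rpow_one]

theorem rNorm_link (h : IsLinking T r τ) {x : X} {y : Y} (hxy : T x y) :
    h.rNorm.toFun (x, -y) ≤ τ := by
  change linkedGauge T r τ _ ^ (1 / r) ≤ _
  rw [one_div]
  exact (Real.rpow_inv_le_iff_of_pos (h.linkedGauge_nonneg _) h.pos.le h.r_pos).2
    (h.linkedGauge_link hxy)

theorem rNorm_isComplete [CompleteSpace X] [CompleteSpace Y] (h : IsLinking T r τ) :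
    h.rNorm.IsComplete := by
  intro s hs
  simp only [rNorm_rpow] at hs ⊢
  have hm : 0 < min 1 τ := lt_min zero_lt_one h.pos
  have hc : CauchySeq s := by
    refine Metric.cauchySeq_iff.2 fun ε hε => ?_
    obtain ⟨k, hk⟩ := hs ((min 1 τ) ^ r * ε ^ r) (by positivity)
    refine ⟨k, fun m hmk n hnk => ?_⟩
    have h1 := (h.norm_le_linkedGauge (s m - s n)).trans_lt (hk m n hmk hnk)
    rw [dist_eq_norm]
    exact (Real.rpow_lt_rpow_iff (norm_nonneg _) hε.le h.r_pos).1
      (lt_of_mul_lt_mul_left h1 (by positivity))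
  obtain ⟨z, hz⟩ := cauchySeq_tendsto_of_complete hc
  refine ⟨z, fun ε hε => ?_⟩
  have h1 : Tendsto (fun n => 2 * ‖s n - z‖ ^ r) atTop (𝓝 (2 * 0 ^ r)) :=
    ((tendsto_iff_norm_sub_tendsto_zero.1 hz).rpow_const (Or.inr h.r_pos.le)).const_mul 2
  rw [Real.zero_rpow h.r_pos.ne', mul_zero] at h1
  obtain ⟨k, hk⟩ := eventually_atTop.1 (h1.eventually_lt_const hε)
  exact ⟨k, fun n hn => (h.linkedGauge_le_norm _).trans_lt (hk n hn)⟩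

end IsLinking

end RNormSum

/-! ### Hausdorff distance for an r-norm. -/

section HausdorffDistance

namespace RNorm

variable {r : ℝ} {Z : Type w} [AddCommGroup Z] [Module ℝ Z] (N : RNorm r Z)

theorem map_zero : N.toFun 0 = 0 := by simpa using N.smul_eq 0 0

theorem nonneg (z : Z) : 0 ≤ N.toFun z := by
  rcases eq_or_ne z 0 with rfl | hz
  · exact N.map_zero.ge
  · exact (N.pos_of_ne_zero z hz).le

theorem map_sub_rev (z z' : Z) : N.toFun (z - z') = N.toFun (z' - z) := by
  rw [← neg_sub, ← neg_one_smul ℝ, N.smul_eq]; simp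

theorem hausdorffDistance_nonneg (A B : Set Z) : 0 ≤ N.hausdorffDistance A B :=
  le_max_of_le_left (Real.iSup_nonneg fun _ => Real.iInf_nonneg fun _ => N.nonneg _)

theorem bddBelow_range_sub {ι : Type*} (z : Z) (f : ι → Z) :
    BddBelow (range fun i => N.toFun (z - f i)) :=
  ⟨0, by rintro _ ⟨i, rfl⟩; exact N.nonneg _⟩

theorem hausdorffDistance_le {A B : Set Z} {δ : ℝ} (hδ : 0 ≤ δ)
    (hA : ∀ a ∈ A, ∃ b ∈ B, N.toFun (a - b) ≤ δ) (hB : ∀ b ∈ B, ∃ a ∈ A, N.toFun (b - a) ≤ δ) :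
    N.hausdorffDistance A B ≤ δ := by
  refine max_le (Real.iSup_le (fun a => ?_) hδ) (Real.iSup_le (fun b => ?_) hδ)
  · obtain ⟨b, hb, h⟩ := hA a a.2
    exact (ciInf_le (N.bddBelow_range_sub _ _) ⟨b, hb⟩).trans h
  · obtain ⟨a, ha, h⟩ := hB b b.2
    exact (ciInf_le (N.bddBelow_range_sub _ _) ⟨a, ha⟩).trans h

theorem hausdorffDistance_comm (A B : Set Z) : N.hausdorffDistance A B = N.hausdorffDistance B A :=
  max_comm _ _

theorem exists_lt_of_hausdorffDistance_lt {A B : Set Z} {δ C : ℝ} (hAC : ∀ a ∈ A, N.toFun a ≤ C)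
    (h0 : (0 : Z) ∈ B) (h : N.hausdorffDistance A B < δ) {a : Z} (ha : a ∈ A) :
    ∃ b ∈ B, N.toFun (a - b) < δ := by
  have : Nonempty B := ⟨⟨0, h0⟩⟩
  have h1 : (⨅ b : B, N.toFun (a - b)) ≤ ⨆ a : A, ⨅ b : B, N.toFun ((a : Z) - (b : Z)) := by
    -- The real supremum of an unbounded family is 0 by convention, so boundedness is needed;
    -- comparison with 0 in B supplies the bound C.
    refine le_ciSup (f := fun a : A => ⨅ b : B, N.toFun ((a : Z) - (b : Z))) ⟨C, ?_⟩ ⟨a, ha⟩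
    rintro _ ⟨a', rfl⟩
    refine (ciInf_le (N.bddBelow_range_sub _ _) ⟨0, h0⟩).trans ?_
    simpa using hAC a' a'.2
  obtain ⟨b, hb⟩ := exists_lt_of_ciInf_lt ((h1.trans (le_max_left _ _)).trans_lt h)
  exact ⟨b, b.2, hb⟩

end RNorm

end HausdorffDistance

/-! ### Upper bounds for d_r. -/

section Distances

variable {X : Type u} {Y : Type v} [NormedAddCommGroup X] [NormedSpace ℝ X]
  [NormedAddCommGroup Y] [NormedSpace ℝ Y] {r : ℝ}

theorem dR_le_hausdorffDistance {Z : Type (max u v)} [AddCommGroup Z] [Module ℝ Z] (N : RNorm r Z)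
    (hN : N.IsComplete) (U : X →ₗ[ℝ] Z) (V : Y →ₗ[ℝ] Z) (hU : ∀ x, N.toFun (U x) = ‖x‖)
    (hV : ∀ y, N.toFun (V y) = ‖y‖) :
    dR r X Y ≤
      N.hausdorffDistance (U '' Metric.closedBall 0 1) (V '' Metric.closedBall 0 1) := by
  unfold dR
  refine csInf_le ⟨0, ?_⟩ ⟨Z, inferInstance, inferInstance, N, U, V, hN, hU, hV, rfl⟩
  rintro _ ⟨Z, _, _, N, U, V, -, -, -, rfl⟩
  exact N.hausdorffDistance_nonneg _ _

theorem IsLinking.dR_le [CompleteSpace X] [CompleteSpace Y] {T : X → Y → Prop} {τ δ : ℝ}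
    (h : IsLinking T r τ) (hδ : 0 ≤ δ)
    (hX : ∀ x : X, ‖x‖ ≤ 1 → ∃ y : Y, ‖y‖ ≤ 1 ∧ h.rNorm.toFun (x, -y) ≤ δ)
    (hY : ∀ y : Y, ‖y‖ ≤ 1 → ∃ x : X, ‖x‖ ≤ 1 ∧ h.rNorm.toFun (x, -y) ≤ δ) :
    dR r X Y ≤ δ := by
  refine (dR_le_hausdorffDistance h.rNorm h.rNorm_isComplete (LinearMap.inl ℝ X Y)
    (LinearMap.inr ℝ X Y)
    (fun x => h.rNorm_eq_of_linkedGauge_eq (norm_nonneg x) (h.linkedGauge_left x))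
    (fun y => h.rNorm_eq_of_linkedGauge_eq (norm_nonneg y) (h.linkedGauge_right y))).trans ?_
  have e : ∀ (x : X) (y : Y), LinearMap.inl ℝ X Y x - LinearMap.inr ℝ X Y y = (x, -y) := by
    intro x y; simp
  refine h.rNorm.hausdorffDistance_le hδ ?_ ?_
  · rintro _ ⟨x, hx, rfl⟩
    obtain ⟨y, hy, hxy⟩ := hX x (by simpa using hx)
    exact ⟨_, ⟨y, by simpa using hy, rfl⟩, by rwa [e]⟩
  · rintro _ ⟨y, hy, rfl⟩
    obtain ⟨x, hx, hxy⟩ := hY y (by simpa using hy)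
    exact ⟨_, ⟨x, by simpa using hx, rfl⟩, by rwa [h.rNorm.map_sub_rev, e]⟩

/-- With no links the construction is the plain r-sum of X and Y. It gives d_r ≤ 1 and shows that
the infimum defining d_r is over a nonempty set. -/
theorem isLinking_empty (hr0 : 0 < r) (hr1 : r ≤ 1) :
    IsLinking (fun (_ : X) (_ : Y) => False) r 1 := by
  have hl : ∀ l : List (ℝ × X × Y), (∀ e ∈ l, False) → l = [] := fun l hl =>
    List.eq_nil_iff_forall_not_mem.2 hl
  refine ⟨one_pos, hr0, hr1, False.elim, False.elim, fun l h => ?_, fun l h => ?_⟩ <;>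
  · rw [hl l h]; simp

theorem dR_le_one [CompleteSpace X] [CompleteSpace Y] (hr0 : 0 < r) (hr1 : r ≤ 1) :
    dR r X Y ≤ 1 := by
  have h := isLinking_empty (X := X) (Y := Y) hr0 hr1
  refine h.dR_le zero_le_one (fun x hx => ⟨0, by simp, ?_⟩) (fun y hy => ⟨0, by simp, ?_⟩)
  · rw [neg_zero, h.rNorm_eq_of_linkedGauge_eq (norm_nonneg x) (h.linkedGauge_left x)]
    exact hx
  · rw [h.rNorm_eq_of_linkedGauge_eq (norm_nonneg (-y)) (h.linkedGauge_right (-y)), norm_neg]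
    exact hy

theorem IsBallCorrespondence.dR_le [CompleteSpace X] [CompleteSpace Y] {T : X → Y → Prop} {δ : ℝ}
    (h : IsBallCorrespondence T δ) (hr0 : 0 < r) (hr1 : r < 1) {n : ℕ}
    (hn : 2 ^ (n + 2) * δ ≤ 1 / 8) :
    dR r X Y ≤ linkingConstant r * (16 * (1 / 2 ^ n + (n + 3) * δ)) := by
  have hδ := h.nonneg
  have hθ : (0 : ℝ) < 16 * (1 / 2 ^ n + (n + 3) * δ) := by positivity
  have hl := (h.isApproxAffine hn).isLinking (h.swap.isApproxAffine hn) hθ hr0 hr1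
  refine hl.dR_le hl.pos.le (fun x hx => ?_) (fun y hy => ?_)
  · obtain ⟨y, hy⟩ := h.exists_right x hx
    exact ⟨y, h.norm_right_le hy, hl.rNorm_link hy⟩
  · obtain ⟨x, hx⟩ := h.exists_left y hy
    exact ⟨x, h.norm_left_le hx, hl.rNorm_link hx⟩

end Distances

/-! ### Gromov–Hausdorff distance, correspondences, and the lower bound. -/

section GromovHausdorff

variable {X : Type u} {Y : Type v} [NormedAddCommGroup X] [NormedSpace ℝ X]
  [NormedAddCommGroup Y] [NormedSpace ℝ Y] {r : ℝ}

theorem ghDistance_nonneg (A : Type u) (B : Type v) [PseudoMetricSpace A] [PseudoMetricSpace B] :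
    0 ≤ ghDistance A B :=
  Real.sInf_nonneg fun _ h => h.1

theorem hausdorffEDist_range_le {A B M : Type*} [PseudoMetricSpace M] {i : A → M} {j : B → M}
    {ε : ℝ} (hA : ∀ a, ∃ b, dist (i a) (j b) ≤ ε) (hB : ∀ b, ∃ a, dist (i a) (j b) ≤ ε) :
    Metric.hausdorffEDist (range i) (range j) ≤ ENNReal.ofReal ε := by
  refine Metric.hausdorffEDist_le_of_mem_edist ?_ ?_
  · rintro _ ⟨a, rfl⟩
    obtain ⟨b, hb⟩ := hA a
    exact ⟨_, ⟨b, rfl⟩, by rw [edist_dist]; exact ENNReal.ofReal_le_ofReal hb⟩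
  · rintro _ ⟨b, rfl⟩
    obtain ⟨a, ha⟩ := hB b
    exact ⟨_, ⟨a, rfl⟩, by rw [edist_dist, dist_comm]; exact ENNReal.ofReal_le_ofReal ha⟩

/-- In the sup-normed product every point of either ball is within 1 of the common origin. -/
theorem exists_isometry_closedBall_hausdorffEDist_le_one (X : Type u) (Y : Type v)
    [NormedAddCommGroup X] [NormedAddCommGroup Y] :
    ∃ (M : Type (max u v)) (_ : PseudoMetricSpace M) (i : Metric.closedBall (0 : X) 1 → M)
      (j : Metric.closedBall (0 : Y) 1 → M), Isometry i ∧ Isometry j ∧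
        Metric.hausdorffEDist (range i) (range j) ≤ ENNReal.ofReal 1 := by
  refine ⟨X × Y, inferInstance, fun x => ((x : X), 0), fun y => (0, (y : Y)),
    Isometry.of_dist_eq fun x x' => ?_, Isometry.of_dist_eq fun y y' => ?_,
    hausdorffEDist_range_le (fun x => ⟨⟨0, by simp⟩, ?_⟩) (fun y => ⟨⟨0, by simp⟩, ?_⟩)⟩
  · simp [Prod.dist_eq, Subtype.dist_eq]
  · simp [Prod.dist_eq, Subtype.dist_eq]
  · simpa [Prod.dist_eq] using mem_closedBall_zero_iff.1 x.2
  · simpa [Prod.dist_eq, dist_comm] using mem_closedBall_zero_iff.1 y.2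

theorem dGH_le_one : dGH X Y ≤ 1 := by
  unfold dGH ghDistance
  exact csInf_le ⟨0, fun _ h => h.1⟩
    ⟨zero_le_one, exists_isometry_closedBall_hausdorffEDist_le_one X Y⟩

theorem IsBallCorrespondence.dGH_le {T : X → Y → Prop} {ε : ℝ}
    (h : IsBallCorrespondence T (2 * ε)) (hε : 0 < ε) : dGH X Y ≤ ε := by
  let P := {p : Metric.closedBall (0 : X) 1 × Metric.closedBall (0 : Y) 1 // T p.1 p.2}
  have hX : ∀ x : Metric.closedBall (0 : X) 1, ∃ p : P, p.1.1 = x := fun x => by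
    obtain ⟨y, hy⟩ := h.exists_right x (mem_closedBall_zero_iff.1 x.2)
    exact ⟨⟨(x, ⟨y, by simpa using h.norm_right_le hy⟩), hy⟩, rfl⟩
  have hY : ∀ y : Metric.closedBall (0 : Y) 1, ∃ p : P, p.1.2 = y := fun y => by
    obtain ⟨x, hx⟩ := h.exists_left y (mem_closedBall_zero_iff.1 y.2)
    exact ⟨⟨(⟨x, by simpa using h.norm_left_le hx⟩, y), hx⟩, rfl⟩
  have : Nonempty P := ⟨(hX ⟨0, by simp⟩).choose⟩
  -- Glue the balls by putting related points at distance ε; distortion at most 2ε is what the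
  -- triangle inequality requires.
  let _ : MetricSpace (Metric.closedBall (0 : X) 1 ⊕ Metric.closedBall (0 : Y) 1) :=
    Metric.glueMetricApprox (fun p : P => p.1.1) (fun p : P => p.1.2) ε hε fun p q => by
      simpa [Subtype.dist_eq, dist_eq_norm] using h.distortion p.2 q.2
  unfold dGH ghDistance
  refine csInf_le ⟨0, fun _ h => h.1⟩ ⟨hε.le, _, inferInstance, Sum.inl, Sum.inr,
    Isometry.of_dist_eq fun _ _ => rfl, Isometry.of_dist_eq fun _ _ => rfl,
    hausdorffEDist_range_le (fun x => ?_) (fun y => ?_)⟩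
  · obtain ⟨p, rfl⟩ := hX x
    exact ⟨p.1.2, (Metric.glueDist_glued_points (fun p : P => p.1.1) (fun p : P => p.1.2) ε p).le⟩
  · obtain ⟨p, rfl⟩ := hY y
    exact ⟨p.1.1, (Metric.glueDist_glued_points (fun p : P => p.1.1) (fun p : P => p.1.2) ε p).le⟩

theorem exists_ballCorrespondence_of_dGH_lt {ε : ℝ} (h : dGH X Y < ε) :
    ∃ T : X → Y → Prop, IsBallCorrespondence T (2 * ε) := by
  have hε : 0 < ε := (ghDistance_nonneg _ _).trans_lt h
  unfold dGH ghDistance at h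
  obtain ⟨ε', ⟨-, M, _, i, j, hi, hj, hij⟩, hlt⟩ := exists_lt_of_csInf_lt
    (by exact ⟨1, zero_le_one, exists_isometry_closedBall_hausdorffEDist_le_one X Y⟩) h
  have hij' : Metric.hausdorffEDist (range i) (range j) < ENNReal.ofReal ε :=
    hij.trans_lt ((ENNReal.ofReal_lt_ofReal_iff hε).2 hlt)
  refine ⟨fun x y => ∃ (hx : ‖x‖ ≤ 1) (hy : ‖y‖ ≤ 1),
    dist (i ⟨x, mem_closedBall_zero_iff.2 hx⟩) (j ⟨y, mem_closedBall_zero_iff.2 hy⟩) < ε,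
    fun h => h.1, fun h => h.2.1, fun x hx => ?_, fun y hy => ?_, ?_⟩
  · obtain ⟨_, ⟨y, rfl⟩, hy⟩ := Metric.exists_edist_lt_of_hausdorffEDist_lt
      (mem_range_self (f := i) ⟨x, mem_closedBall_zero_iff.2 hx⟩) hij'
    rw [edist_dist, ENNReal.ofReal_lt_ofReal_iff hε] at hy
    exact ⟨y, hx, mem_closedBall_zero_iff.1 y.2, hy⟩
  · rw [Metric.hausdorffEDist_comm] at hij'
    obtain ⟨_, ⟨x, rfl⟩, hx⟩ := Metric.exists_edist_lt_of_hausdorffEDist_lt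
      (mem_range_self (f := j) ⟨y, mem_closedBall_zero_iff.2 hy⟩) hij'
    rw [edist_dist, ENNReal.ofReal_lt_ofReal_iff hε, dist_comm] at hx
    exact ⟨x, mem_closedBall_zero_iff.1 x.2, hy, hx⟩
  · rintro x x' y y' ⟨hx, hy, hxy⟩ ⟨hx', hy', hxy'⟩
    have h1 := hi.dist_eq ⟨x, mem_closedBall_zero_iff.2 hx⟩ ⟨x', mem_closedBall_zero_iff.2 hx'⟩
    have h2 := hj.dist_eq ⟨y, mem_closedBall_zero_iff.2 hy⟩ ⟨y', mem_closedBall_zero_iff.2 hy'⟩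
    have h3 := dist_dist_dist_le (i ⟨x, mem_closedBall_zero_iff.2 hx⟩) (i ⟨x', mem_closedBall_zero_iff.2 hx'⟩)
      (j ⟨y, mem_closedBall_zero_iff.2 hy⟩) (j ⟨y', mem_closedBall_zero_iff.2 hy'⟩)
    rw [h1, h2, Real.dist_eq, Subtype.dist_eq, Subtype.dist_eq, dist_eq_norm, dist_eq_norm] at h3
    linarith

/-- Two vectors which are close in an `r`-normed space have close norms, once the balls are
Hausdorff close. -/
theorem RNorm.norm_le_norm_add {Z : Type w} [AddCommGroup Z] [Module ℝ Z] (N : RNorm r Z)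
    (hr0 : 0 < r) (hr1 : r ≤ 1) {U : X →ₗ[ℝ] Z} {V : Y →ₗ[ℝ] Z}
    (hU : ∀ x, N.toFun (U x) = ‖x‖) {δ : ℝ} (hδ : 0 < δ)
    (hYX : ∀ y, ‖y‖ ≤ 1 → ∃ x, ‖x‖ ≤ 1 ∧ N.toFun (V y - U x) < δ) {u : X} {v : Y}
    (hv : ‖v‖ ≤ 2) (huv : N.toFun (U u - V v) ^ r ≤ 2 * δ ^ r) :
    ‖u‖ ≤ ‖v‖ + 4 ^ (1 / r) * δ := by
  have hv1 : ‖‖v‖⁻¹ • v‖ ≤ 1 := norm_inv_norm_smul_le_one v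
  obtain ⟨x, hx, hxy⟩ := hYX _ hv1
  have hvv : ‖v‖ • (‖v‖⁻¹ • v) = v := by
    rcases eq_or_ne v 0 with rfl | hv0
    · simp
    · rw [smul_smul, mul_inv_cancel₀ (norm_ne_zero_iff.2 hv0), one_smul]
  -- V v is replaced by a vector of U(X) of norm at most ‖v‖, so that the final comparison takes
  -- place in the Banach space X.
  have h1 : N.toFun (V v - U (‖v‖ • x)) ≤ 2 * δ := by
    have : V v - U (‖v‖ • x) = ‖v‖ • (V (‖v‖⁻¹ • v) - U x) := by
      rw [smul_sub, ← map_smul, ← map_smul, hvv]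
    rw [this, N.smul_eq, abs_norm]
    exact mul_le_mul hv hxy.le (N.nonneg _) zero_le_two
  have h2 : N.toFun (V v - U (‖v‖ • x)) ^ r ≤ 2 * δ ^ r := by
    refine (Real.rpow_le_rpow (N.nonneg _) h1 hr0.le).trans ?_
    rw [Real.mul_rpow zero_le_two hδ.le]
    gcongr
    simpa using Real.rpow_le_rpow_of_exponent_le one_le_two hr1
  have h3 : ‖u - ‖v‖ • x‖ ^ r ≤ 4 * δ ^ r := by
    have h := N.add_rpow_le (U u - V v) (V v - U (‖v‖ • x))
    rw [sub_add_sub_cancel, ← map_sub, hU] at h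
    linarith
  have h4 : ‖u - ‖v‖ • x‖ ≤ 4 ^ (1 / r) * δ := by
    refine (Real.rpow_le_rpow_iff (norm_nonneg _) (by positivity) hr0).1 (h3.trans_eq ?_)
    rw [Real.mul_rpow (by positivity) hδ.le, ← Real.rpow_mul (by norm_num),
      one_div_mul_cancel hr0.ne', Real.rpow_one]
  have h5 : ‖‖v‖ • x‖ ≤ ‖v‖ := by
    rw [norm_smul, norm_norm]
    exact mul_le_of_le_one_right (norm_nonneg _) hx
  linarith [norm_le_norm_add_norm_sub' u (‖v‖ • x)]

theorem dGH_le_of_hausdorffDistance_lt {Z : Type w} [AddCommGroup Z] [Module ℝ Z] (N : RNorm r Z)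
    (hr0 : 0 < r) (hr1 : r ≤ 1) {U : X →ₗ[ℝ] Z} {V : Y →ₗ[ℝ] Z}
    (hU : ∀ x, N.toFun (U x) = ‖x‖) (hV : ∀ y, N.toFun (V y) = ‖y‖) {δ : ℝ}
    (h : N.hausdorffDistance (U '' Metric.closedBall 0 1) (V '' Metric.closedBall 0 1) < δ) :
    dGH X Y ≤ 4 ^ (1 / r) * δ / 2 := by
  have hδ : 0 < δ := (N.hausdorffDistance_nonneg _ _).trans_lt h
  have hXY : ∀ x, ‖x‖ ≤ 1 → ∃ y, ‖y‖ ≤ 1 ∧ N.toFun (U x - V y) < δ := fun x hx => by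
    obtain ⟨_, ⟨y, hy, rfl⟩, hxy⟩ := N.exists_lt_of_hausdorffDistance_lt
      (A := U '' Metric.closedBall 0 1) (B := V '' Metric.closedBall 0 1) (C := 1)
      (by rintro _ ⟨x, hx, rfl⟩; simpa [hU] using hx) ⟨0, by simp, map_zero V⟩ h
      (mem_image_of_mem U (by simpa using hx : x ∈ Metric.closedBall (0 : X) 1))
    exact ⟨y, by simpa using hy, hxy⟩
  rw [N.hausdorffDistance_comm] at h
  have hYX : ∀ y, ‖y‖ ≤ 1 → ∃ x, ‖x‖ ≤ 1 ∧ N.toFun (V y - U x) < δ := fun y hy => by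
    obtain ⟨_, ⟨x, hx, rfl⟩, hxy⟩ := N.exists_lt_of_hausdorffDistance_lt
      (A := V '' Metric.closedBall 0 1) (B := U '' Metric.closedBall 0 1) (C := 1)
      (by rintro _ ⟨y, hy, rfl⟩; simpa [hV] using hy) ⟨0, by simp, map_zero U⟩ h
      (mem_image_of_mem V (by simpa using hy : y ∈ Metric.closedBall (0 : Y) 1))
    exact ⟨x, by simpa using hx, hxy⟩
  refine IsBallCorrespondence.dGH_le
    (T := fun x y => ‖x‖ ≤ 1 ∧ ‖y‖ ≤ 1 ∧ N.toFun (U x - V y) < δ)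
    ⟨fun h => h.1, fun h => h.2.1, fun x hx => ?_, fun y hy => ?_, ?_⟩ (by positivity)
  · obtain ⟨y, hy, hxy⟩ := hXY x hx
    exact ⟨y, hx, hy, hxy⟩
  · obtain ⟨x, hx, hxy⟩ := hYX y hy
    exact ⟨x, hx, hy, by rwa [N.map_sub_rev]⟩
  · rintro x x' y y' ⟨hx, hy, hxy⟩ ⟨hx', hy', hxy'⟩
    have h1 : N.toFun (U (x - x') - V (y - y')) ^ r ≤ 2 * δ ^ r := by
      have e : U (x - x') - V (y - y') = (U x - V y) + (V y' - U x') := by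
        rw [map_sub, map_sub]; abel
      have h2 := Real.rpow_le_rpow (N.nonneg _) hxy.le hr0.le
      have h3 := Real.rpow_le_rpow (N.nonneg _) hxy'.le hr0.le
      rw [N.map_sub_rev] at h3
      rw [e]
      linarith [N.add_rpow_le (U x - V y) (V y' - U x')]
    have h2 := N.norm_le_norm_add hr0 hr1 hU hδ hYX
      (by linarith [norm_sub_le y y']) h1
    rw [N.map_sub_rev] at h1
    have h3 := N.norm_le_norm_add hr0 hr1 hV hδ hXY
      (by linarith [norm_sub_le x x']) h1
    exact abs_le.2 ⟨by linarith, by linarith⟩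

theorem two_rpow_mul_dGH_le_dR [CompleteSpace X] [CompleteSpace Y] (hr0 : 0 < r) (hr1 : r ≤ 1) :
    (2 : ℝ) ^ (-2 / r + 1) * dGH X Y ≤ dR r X Y := by
  have hl := isLinking_empty (X := X) (Y := Y) hr0 hr1
  unfold dR
  refine le_csInf ⟨_, X × Y, inferInstance, inferInstance, hl.rNorm, LinearMap.inl ℝ X Y,
    LinearMap.inr ℝ X Y, hl.rNorm_isComplete,
    fun x => hl.rNorm_eq_of_linkedGauge_eq (norm_nonneg x) (hl.linkedGauge_left x),
    fun y => hl.rNorm_eq_of_linkedGauge_eq (norm_nonneg y) (hl.linkedGauge_right y), rfl⟩ ?_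
  rintro _ ⟨Z, _, _, N, U, V, -, hU, hV, rfl⟩
  refine le_of_forall_gt_imp_ge_of_dense fun δ hδ => ?_
  have h1 := dGH_le_of_hausdorffDistance_lt N hr0 hr1 hU hV hδ
  have h2 : (2 : ℝ) ^ (-2 / r + 1) * (4 ^ (1 / r) * δ / 2) = δ := by
    have h4 : (4 : ℝ) ^ (1 / r) = 2 ^ (2 / r) := by
      rw [show (4 : ℝ) = 2 ^ (2 : ℝ) by norm_num, ← Real.rpow_mul zero_le_two, mul_one_div]
    rw [h4, Real.rpow_add two_pos, Real.rpow_one, neg_div, Real.rpow_neg zero_le_two]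
    field_simp
  calc (2 : ℝ) ^ (-2 / r + 1) * dGH X Y ≤ 2 ^ (-2 / r + 1) * (4 ^ (1 / r) * δ / 2) := by gcongr
    _ = δ := h2

theorem exists_dR_le_of_dGH_lt (hr0 : 0 < r) (hr1 : r < 1) {η : ℝ} (hη : 0 < η) :
    ∃ ε > 0, ∀ (X : Type u) (Y : Type v) [NormedAddCommGroup X] [NormedSpace ℝ X] [CompleteSpace X]
      [NormedAddCommGroup Y] [NormedSpace ℝ Y] [CompleteSpace Y], dGH X Y < ε → dR r X Y ≤ η := by
  have hK := linkingConstant_pos hr0 hr1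
  obtain ⟨n, hn⟩ := exists_pow_lt_of_lt_one (show 0 < η / (32 * linkingConstant r) by positivity)
    (show (1 / 2 : ℝ) < 1 by norm_num)
  rw [div_pow, one_pow, lt_div_iff₀ (by positivity)] at hn
  -- With n fixed so that the term in 1 / 2 ^ n is below η / 2, the first bound on ε makes the
  -- Mazur–Ulam iteration fit in the ball and the second keeps the term in (n + 3) * (2 * ε) below η
  -- / 2.
  refine ⟨min (1 / (2 ^ (n + 2) * 16)) (η / (64 * linkingConstant r * (n + 3))),
    lt_min (by positivity) (by positivity), fun X Y _ _ _ _ _ _ h => ?_⟩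
  obtain ⟨T, hT⟩ := exists_ballCorrespondence_of_dGH_lt h
  set ε := min (1 / (2 ^ (n + 2) * 16)) (η / (64 * linkingConstant r * (n + 3)))
  have h1 : ε ≤ 1 / (2 ^ (n + 2) * 16) := min_le_left _ _
  have h2 : ε ≤ η / (64 * linkingConstant r * (n + 3)) := min_le_right _ _
  rw [le_div_iff₀ (by positivity)] at h1 h2
  refine (hT.dR_le hr0 hr1 (n := n) (by linarith)).trans ?_
  linarith

end GromovHausdorff

/-! ### The modulus f_r. -/

theorem theorem3p6 (r : ℝ) (hr0 : 0 < r) (hr1 : r < 1) :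
    ∃ f : ℝ → ℝ, MapsTo f (Ioc 0 1) (Ioc 0 1) ∧ f 0 = 0 ∧ Tendsto f (𝓝[>] 0) (𝓝 0) ∧
      ∀ (X : Type u) (Y : Type v) [NormedAddCommGroup X] [NormedSpace ℝ X] [CompleteSpace X]
        [NormedAddCommGroup Y] [NormedSpace ℝ Y] [CompleteSpace Y],
        dGH X Y ∈ Icc (0 : ℝ) 1 ∧
        (2 : ℝ) ^ (-2 / r + 1) * dGH X Y ≤ dR r X Y ∧
        dR r X Y ≤ f (dGH X Y) := by
  let D : ℝ → Set ℝ := fun t => {δ | ∃ (X : Type u) (Y : Type v) (_ : NormedAddCommGroup X)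
    (_ : NormedSpace ℝ X) (_ : CompleteSpace X) (_ : NormedAddCommGroup Y) (_ : NormedSpace ℝ Y)
    (_ : CompleteSpace Y), dGH X Y ≤ t ∧ δ = dR r X Y}
  have hD : ∀ t, ∀ δ ∈ D t, δ ≤ 1 := by
    rintro t _ ⟨X, Y, _, _, _, _, _, _, -, rfl⟩
    exact dR_le_one hr0 hr1.le
  -- The least monotone modulus is the supremum of d_r over all pairs with Gromov–Hausdorff distance
  -- at most t; the maximum with t keeps it positive for t > 0.
  refine ⟨fun t => if t = 0 then 0 else max t (sSup (D t)), ?_, if_pos rfl, ?_, ?_⟩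
  · intro t ht
    simp only [if_neg ht.1.ne']
    exact ⟨lt_max_of_lt_left ht.1, max_le ht.2 (Real.sSup_le (hD t) zero_le_one)⟩
  · rw [Metric.tendsto_nhds]
    intro η hη
    obtain ⟨ε, hε, h⟩ := exists_dR_le_of_dGH_lt.{u, v} hr0 hr1 (half_pos hη)
    filter_upwards [Ioo_mem_nhdsGT (lt_min hε hη)] with t ht
    have ht1 := ht.2.trans_le (min_le_left _ _)
    have ht2 := ht.2.trans_le (min_le_right _ _)
    rw [if_neg ht.1.ne', Real.dist_eq, sub_zero, abs_of_pos (lt_max_of_lt_left ht.1)]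
    refine max_lt ht2 (lt_of_le_of_lt (Real.sSup_le ?_ (half_pos hη).le) (half_lt_self hη))
    rintro _ ⟨X, Y, _, _, _, _, _, _, hXY, rfl⟩
    exact h X Y (hXY.trans_lt ht1)
  · intro X Y _ _ _ _ _ _
    refine ⟨⟨ghDistance_nonneg _ _, dGH_le_one⟩, two_rpow_mul_dGH_le_dR hr0 hr1.le, ?_⟩
    beta_reduce
    split_ifs with h0
    -- At distance 0 the uniform estimate applies for every η > 0, so d_r is at most 0.
    · refine le_of_forall_gt_imp_ge_of_dense fun η hη => ?_
      obtain ⟨ε, hε, h⟩ := exists_dR_le_of_dGH_lt.{u, v} hr0 hr1 hη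
      exact h X Y (h0.trans_lt hε)
    · exact le_max_of_le_right (le_csSup ⟨1, hD _⟩ ⟨X, Y, _, _, ‹_›, _, _, ‹_›, le_rfl, rfl⟩)
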